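/- Let $d\ge 1$ be an integer. The Fourier transform is normalised by $\widehat f(\xi)=\int_{\mathbb R^d}f(t)e^{-2i\pi\langle t,\xi\rangle}\,dt$ for $f\in L^1(\mathbb R^d)\cap L^2(\mathbb R^d)$ and extended to $L^2(\mathbb R^d)$ by continuity. For a set $E\subset\mathbb R^d$ of finite Lebesgue measure $|E|$, let $E^*$ be the open ball centred at the origin with $|E^*|=|E|$. For a measurable $\varphi:\mathbb R^d\to\mathbb C$ whose level sets $\{|\varphi|>\lambda\}$, $\lambda>0$, have finite measure, the symmetric decreasing rearrangement of $\varphi$ is $$\varphi^*(x)=|\varphi|^*(x)=\int_0^{\infty}\chi_{\{y\in\mathbb R^d:\ |\varphi(y)|>\lambda\}^*}(x)\,d\lambda .$$ Let $s>0$ and let $\varphi\in L^2(\mathbb R^d)$ be complex-valued. Then $\varphi^*\in L^2(\mathbb R^d)$, and $$\int_{\mathbb R^d}(1+|\xi|^2)^{-s}\,|\widehat{\varphi}(\xi)|^2\,d\xi\ \le\ \int_{\mathbb R^d}(1+|\xi|^2)^{-s}\,|\widehat{\varphi^*}(\xi)|^2\,d\xi ,$$ where both integrals are finite. -/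

import Mathlib

open MeasureTheory Set
open scoped ENNReal FourierTransform

noncomputable section

/-- The symmetric rearrangement `E^*` of a set `E ⊆ ℝ^d` of finite measure: the open ball centred at
the origin whose radius `r` is given by `|B(0,1)| r^d = |E|`. -/
def symmRearrSet {d : ℕ} (E : Set (EuclideanSpace ℝ (Fin d))) : Set (EuclideanSpace ℝ (Fin d)) :=
  Metric.ball 0
    ((volume.real E / volume.real (Metric.ball (0 : EuclideanSpace ℝ (Fin d)) 1)) ^
      (1 / (d : ℝ)))

/-- The symmetric decreasing rearrangement `φ^* = |φ|^*`, by its level-cake representation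
`φ^*(x) = ∫_0^∞ χ_{{|φ| > t}^*}(x) dt`. It is `[0, ∞]`-valued: the value `∞` can occur, at `x = 0`
only, when `φ` is essentially unbounded. -/
def symmRearr {d : ℕ} (φ : EuclideanSpace ℝ (Fin d) → ℂ) (x : EuclideanSpace ℝ (Fin d)) : ℝ≥0∞ :=
  ∫⁻ t in Ioi (0 : ℝ), (symmRearrSet {y | t < ‖φ y‖}).indicator (fun _ => (1 : ℝ≥0∞)) x

/-- `φ^*` as a complex-valued function; only the null set `{0}` can be affected by `toReal`. -/
def symmRearrC {d : ℕ} (φ : EuclideanSpace ℝ (Fin d) → ℂ) (x : EuclideanSpace ℝ (Fin d)) : ℂ :=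
  ((symmRearr φ x).toReal : ℂ)

/-- The integrand `(1 + |ξ|^2)^{-s} |f̂(ξ)|^2`, where `f̂` is the Fourier transform of `f ∈ L^2`, that
is, the continuous extension to `L^2` of `f̂(ξ) = ∫ f(t) e^{-2 i π ⟨t, ξ⟩} dt`. -/
def negSobolevDensity {d : ℕ} (s : ℝ) (f : EuclideanSpace ℝ (Fin d) → ℂ) (hf : MemLp f 2 volume)
    (ξ : EuclideanSpace ℝ (Fin d)) : ℝ :=
  (1 + ‖ξ‖ ^ 2) ^ (-s) * ‖(𝓕 (hf.toLp f) : Lp ℂ 2 (volume : Measure (EuclideanSpace ℝ (Fin d)))) ξ‖ ^ 2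

end

/-! The weight `(1 + ‖ξ‖ ^ 2) ^ (-s)` is, by the Gamma integral, a positive superposition of
Gaussians `exp (-t ‖ξ‖ ^ 2)`, so it suffices to compare Gaussian energies for each `t > 0`. By
Fourier duality the Gaussian energy of `f` is the double integral of `k ‖x - y‖ * f x * conj (f y)`,
where `k` is the heat kernel, positive and decreasing (`integral_gaussian_mul_norm_fourier_sq`).
Replacing `f` by `|f|` can only increase it. What remains is Riesz's rearrangement inequality for a
decreasing radial kernel and a continuous compactly supported `f ≥ 0`.

That inequality (`exists_radial_rearrangement`) follows from polarization, which moves the larger of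
the values at `x` and at its mirror image to a fixed side of a hyperplane. This preserves the
distribution of values, does not worsen the modulus of continuity, and does not lower the energy
(`integral_kernel_le_polarization`). The functions supported in a fixed ball, equimeasurable with
`f`, with no worse modulus and no smaller energy form a compact set, so one of them has least second
moment. A polarization towards the origin that changed it would strictly lower that moment. The
minimizer is therefore radially decreasing, which identifies it as the rearrangement of `f`.

For general `φ` in `L²`, rearrangement is nonexpansive (`eLpNorm_symmRearrC_sub_le`, from
Hardy-Littlewood) and the Sobolev norm of order `-s` is dominated by the `L²` norm, so the
inequality passes to limits of continuous compactly supported functions. -/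

/-! ### Hyperplane reflections and polarization -/

section Polarization

variable {V : Type*} [NormedAddCommGroup V] [InnerProductSpace ℝ V]

/-- The reflection across the hyperplane `{x | ⟪u, x⟫ = c}`, for a unit vector `u`. -/
def hyperplaneReflection (u : V) (c : ℝ) (x : V) : V := x + (2 * (c - inner ℝ u x)) • u

/-- The two-point rearrangement (polarization) of `g` with respect to the half-space
`{x | ⟪u, x⟫ ≤ c}`. -/
noncomputable def polarization (u : V) (c : ℝ) (g : V → ℝ) (x : V) : ℝ :=
  if inner ℝ u x ≤ c then max (g x) (g (hyperplaneReflection u c x))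
  else min (g x) (g (hyperplaneReflection u c x))

variable {u : V} {c : ℝ}

local notation "σ" => hyperplaneReflection u c

lemma inner_hyperplaneReflection (hu : ‖u‖ = 1) (x : V) :
    inner ℝ u (hyperplaneReflection u c x) = 2 * c - inner ℝ u x := by
  simp only [hyperplaneReflection, inner_add_right, inner_smul_right, real_inner_self_eq_norm_sq,
    hu]
  ring

lemma hyperplaneReflection_involutive (hu : ‖u‖ = 1) :
    Function.Involutive (hyperplaneReflection u c) := by
  intro x
  have := inner_hyperplaneReflection (c := c) hu x
  rw [hyperplaneReflection, this, hyperplaneReflection, add_assoc, ← add_smul]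
  have h0 : 2 * (c - inner ℝ u x) + 2 * (c - (2 * c - inner ℝ u x)) = 0 := by ring
  rw [h0, zero_smul, add_zero]

lemma norm_add_smul_sq (hu : ‖u‖ = 1) (x : V) (a : ℝ) :
    ‖x + a • u‖ ^ 2 = ‖x‖ ^ 2 + 2 * a * inner ℝ u x + a ^ 2 := by
  rw [norm_add_sq_real, inner_smul_right, norm_smul, hu, real_inner_comm, mul_one,
    Real.norm_eq_abs, sq_abs]
  ring

lemma norm_hyperplaneReflection_sq (hu : ‖u‖ = 1) (x : V) :
    ‖hyperplaneReflection u c x‖ ^ 2 = ‖x‖ ^ 2 + 4 * c * (c - inner ℝ u x) := by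
  rw [hyperplaneReflection, norm_add_smul_sq hu]
  ring

/-- The sign of the last product tells whether `x` and `y` lie on the same side. Reflecting one of
them then increases their distance, and otherwise it does not; every comparison of distances below
rests on this. -/
lemma norm_sub_hyperplaneReflection_sq (hu : ‖u‖ = 1) (x y : V) :
    ‖x - hyperplaneReflection u c y‖ ^ 2
      = ‖x - y‖ ^ 2 + 4 * (c - inner ℝ u x) * (c - inner ℝ u y) := by
  have : x - hyperplaneReflection u c y = (x - y) + (-(2 * (c - inner ℝ u y))) • u := by
    rw [hyperplaneReflection, neg_smul]; abel
  rw [this, norm_add_smul_sq hu, inner_sub_right]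
  ring

lemma norm_hyperplaneReflection_sub_hyperplaneReflection (hu : ‖u‖ = 1) (x y : V) :
    ‖hyperplaneReflection u c x - hyperplaneReflection u c y‖ = ‖x - y‖ := by
  have h : ‖hyperplaneReflection u c x - hyperplaneReflection u c y‖ ^ 2 = ‖x - y‖ ^ 2 := by
    rw [norm_sub_hyperplaneReflection_sq hu, inner_hyperplaneReflection hu,
      ← norm_neg, neg_sub, norm_sub_hyperplaneReflection_sq hu, norm_sub_rev y x]
    ring
  exact (sq_eq_sq₀ (norm_nonneg _) (norm_nonneg _)).1 h

lemma norm_hyperplaneReflection_sub (hu : ‖u‖ = 1) (x y : V) :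
    ‖hyperplaneReflection u c x - y‖ = ‖x - hyperplaneReflection u c y‖ := by
  conv_lhs => rw [← hyperplaneReflection_involutive (c := c) hu y]
  exact norm_hyperplaneReflection_sub_hyperplaneReflection hu _ _

lemma continuous_hyperplaneReflection : Continuous (hyperplaneReflection u c) := by
  unfold hyperplaneReflection
  fun_prop

lemma measurePreserving_hyperplaneReflection [FiniteDimensional ℝ V] [MeasurableSpace V]
    [BorelSpace V] (hu : ‖u‖ = 1) :
    MeasurePreserving (hyperplaneReflection u c) (volume : Measure V) volume := by
  have h1 := ((Submodule.span ℝ {u})ᗮ.reflection).measurePreserving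
  have h2 := (measurePreserving_add_right (volume : Measure V) ((2 * c) • u)).comp h1
  have h3 : hyperplaneReflection u c
      = (fun x ↦ x + (2 * c) • u) ∘ (Submodule.span ℝ {u})ᗮ.reflection := by
    funext x
    simp only [hyperplaneReflection, Function.comp_apply, Submodule.reflection_orthogonal_apply,
      Submodule.reflection_singleton_apply, hu]
    simp only [RCLike.ofReal_real_eq_id, id, one_pow, div_one, mul_sub, sub_smul, mul_smul]
    rw [two_smul ℕ, two_smul ℝ (inner ℝ u x • u)]
    abel
  rw [h3]
  exact h2

lemma polarization_of_le {g : V → ℝ} {x : V} (hx : inner ℝ u x ≤ c) :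
    polarization u c g x = max (g x) (g (hyperplaneReflection u c x)) := if_pos hx

lemma polarization_of_ge {g : V → ℝ} {x : V} (hx : c ≤ inner ℝ u x) :
    polarization u c g x = min (g x) (g (hyperplaneReflection u c x)) := by
  -- On the hyperplane the reflection fixes `x`, so the two branches of the definition agree there.
  rcases hx.eq_or_lt with h | h
  · have : hyperplaneReflection u c x = x := by simp [hyperplaneReflection, ← h]
    rw [polarization_of_le h.symm.le, this, max_self, min_self]
  · exact if_neg h.not_ge

lemma polarization_hyperplaneReflection_of_le (hu : ‖u‖ = 1) {g : V → ℝ} {x : V}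
    (hx : inner ℝ u x ≤ c) :
    polarization u c g (hyperplaneReflection u c x)
      = min (g x) (g (hyperplaneReflection u c x)) := by
  rw [polarization_of_ge (by rw [inner_hyperplaneReflection hu]; linarith),
    hyperplaneReflection_involutive hu, min_comm]

lemma polarization_hyperplaneReflection_of_ge (hu : ‖u‖ = 1) {g : V → ℝ} {x : V}
    (hx : c ≤ inner ℝ u x) :
    polarization u c g (hyperplaneReflection u c x)
      = max (g x) (g (hyperplaneReflection u c x)) := by
  rw [polarization_of_le (by rw [inner_hyperplaneReflection hu]; linarith),
    hyperplaneReflection_involutive hu, max_comm]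

lemma polarization_eq_or (g : V → ℝ) (x : V) :
    polarization u c g x = g x ∨ polarization u c g x = g (hyperplaneReflection u c x) := by
  unfold polarization
  split_ifs
  · exact max_choice _ _
  · exact min_choice _ _

lemma polarization_nonneg {g : V → ℝ} (hg : ∀ x, 0 ≤ g x) (x : V) : 0 ≤ polarization u c g x := by
  rcases polarization_eq_or (u := u) (c := c) g x with h | h <;> rw [h] <;> exact hg _

lemma polarization_le {g : V → ℝ} {M : ℝ} (hg : ∀ x, g x ≤ M) (x : V) :
    polarization u c g x ≤ M := by
  rcases polarization_eq_or (u := u) (c := c) g x with h | h <;> rw [h] <;> exact hg _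

/-- With `0 ≤ c` the origin is on the near side, so crossing the hyperplane leads away from it. -/
lemma norm_le_norm_hyperplaneReflection (hu : ‖u‖ = 1) (hc : 0 ≤ c) {x : V}
    (hx : inner ℝ u x ≤ c) : ‖x‖ ≤ ‖hyperplaneReflection u c x‖ := by
  refine (sq_le_sq₀ (norm_nonneg _) (norm_nonneg _)).1 ?_
  rw [norm_hyperplaneReflection_sq hu]
  nlinarith [mul_nonneg hc (sub_nonneg.2 hx)]

lemma polarization_eq_zero (hu : ‖u‖ = 1) (hc : 0 ≤ c) {g : V → ℝ} (hg : ∀ x, 0 ≤ g x) {R : ℝ}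
    (hR : ∀ x, R < ‖x‖ → g x = 0) {x : V} (hx : R < ‖x‖) : polarization u c g x = 0 := by
  rcases le_total (inner ℝ u x) c with h | h
  · rw [polarization_of_le h, hR x hx,
      hR _ (hx.trans_le (norm_le_norm_hyperplaneReflection hu hc h)), max_self]
  · rw [polarization_of_ge h, hR x hx, min_eq_left (hg _)]

/-- Polarization does not increase the modulus of continuity. -/
lemma abs_polarization_sub_le (hu : ‖u‖ = 1) {g : V → ℝ} {δ ε : ℝ}
    (hg : ∀ x y, dist x y ≤ δ → |g x - g y| ≤ ε) {x y : V} (hxy : dist x y ≤ δ) :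
    |polarization u c g x - polarization u c g y| ≤ ε := by
  have e1 : |g x - g y| ≤ ε := hg _ _ hxy
  have e2 : |g (σ x) - g (σ y)| ≤ ε := by
    apply hg
    rwa [dist_eq_norm, norm_hyperplaneReflection_sub_hyperplaneReflection hu, ← dist_eq_norm]
  -- For points on opposite sides, reflecting one brings them no farther apart, so all four
  -- differences between values at `x`, `σ x` and at `y`, `σ y` are controlled. This is needed when
  -- a max is compared with a min.
  have opp : 0 ≤ -((c - inner ℝ u x) * (c - inner ℝ u y)) →
      |g x - g (σ y)| ≤ ε ∧ |g (σ x) - g y| ≤ ε := by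
    intro h
    have h1 : ‖x - σ y‖ ≤ ‖x - y‖ := by
      refine (sq_le_sq₀ (norm_nonneg _) (norm_nonneg _)).1 ?_
      rw [norm_sub_hyperplaneReflection_sq hu]
      nlinarith
    rw [dist_eq_norm] at hxy
    refine ⟨hg _ _ (by rw [dist_eq_norm]; linarith), hg _ _ ?_⟩
    rw [dist_eq_norm, norm_hyperplaneReflection_sub hu]
    linarith
  rw [abs_le] at e1 e2
  rcases le_total (inner ℝ u x) c with hx | hx <;> rcases le_total (inner ℝ u y) c with hy | hy
  · rw [polarization_of_le hx, polarization_of_le hy]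
    exact (abs_max_sub_max_le_max _ _ _ _).trans (max_le (abs_le.2 e1) (abs_le.2 e2))
  · obtain ⟨e3, e4⟩ := opp (by nlinarith)
    rw [abs_le] at e3 e4
    rw [polarization_of_le hx, polarization_of_ge hy, abs_le]
    constructor <;> rcases max_cases (g x) (g (σ x)) with h | h <;>
      rcases min_cases (g y) (g (σ y)) with h' | h' <;> linarith
  · obtain ⟨e3, e4⟩ := opp (by nlinarith)
    rw [abs_le] at e3 e4
    rw [polarization_of_ge hx, polarization_of_le hy, abs_le]
    constructor <;> rcases min_cases (g x) (g (σ x)) with h | h <;>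
      rcases max_cases (g y) (g (σ y)) with h' | h' <;> linarith
  · rw [polarization_of_ge hx, polarization_of_ge hy]
    exact (abs_min_sub_min_le_max _ _ _ _).trans (max_le (abs_le.2 e1) (abs_le.2 e2))

lemma continuous_polarization {g : V → ℝ} (hg : Continuous g) :
    Continuous (polarization u c g) := by
  unfold polarization
  have h1 := hg.comp (continuous_hyperplaneReflection (u := u) (c := c))
  refine Continuous.if_le (hg.max h1) (hg.min h1) (by fun_prop) continuous_const fun x hx ↦ ?_
  have : hyperplaneReflection u c x = x := by simp [hyperplaneReflection, ← hx]
  simp [this]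

end Polarization

/-! ### Effect of polarization on distribution, second moment and energy -/

section PolarizationIntegral

variable {V : Type*} [NormedAddCommGroup V] [InnerProductSpace ℝ V] [FiniteDimensional ℝ V]
  [MeasurableSpace V] [BorelSpace V] {u : V} {c : ℝ}

local notation "σ" => hyperplaneReflection u c

lemma integral_comp_of_involutive {X : Type*} [TopologicalSpace X] [MeasurableSpace X]
    [BorelSpace X] {μ : Measure X} {τ : X → X} (hτ : MeasurePreserving τ μ μ)
    (hc : Continuous τ) (hi : Function.Involutive τ) (F : X → ℝ) :
    ∫ x, F (τ x) ∂μ = ∫ x, F x ∂μ :=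
  hτ.integral_comp (Homeomorph.mk (hi.toPerm τ) hc hc).measurableEmbedding F

lemma integral_comp_polarization (hu : ‖u‖ = 1) {g : V → ℝ} {h : ℝ → ℝ}
    (hi : Integrable fun x ↦ h (g x)) (hi' : Integrable fun x ↦ h (polarization u c g x)) :
    ∫ x, h (polarization u c g x) = ∫ x, h (g x) := by
  have hp := measurePreserving_hyperplaneReflection (c := c) hu
  have key := integral_comp_of_involutive hp continuous_hyperplaneReflection
    (hyperplaneReflection_involutive hu)
  have e1 := key fun x ↦ h (g x)
  have e2 := key fun x ↦ h (polarization u c g x)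
  -- Polarization only permutes the two values on each orbit `{x, σ x}`, so the sums over orbits
  -- agree pointwise.
  have e3 : ∫ x, (h (polarization u c g x) + h (polarization u c g (σ x)))
      = ∫ x, (h (g x) + h (g (σ x))) := by
    congr 1 with x
    rcases le_total (inner ℝ u x) c with hx | hx
    · rw [polarization_of_le hx, polarization_hyperplaneReflection_of_le hu hx]
      rcases le_total (g x) (g (σ x)) with h' | h'
      · rw [max_eq_right h', min_eq_left h', add_comm]
      · rw [max_eq_left h', min_eq_right h']
    · rw [polarization_of_ge hx, polarization_hyperplaneReflection_of_ge hu hx]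
      rcases le_total (g x) (g (σ x)) with h' | h'
      · rw [max_eq_right h', min_eq_left h']
      · rw [max_eq_left h', min_eq_right h', add_comm]
  have i1 : Integrable fun x ↦ h (g (σ x)) := hp.integrable_comp_of_integrable hi
  have i2 : Integrable fun x ↦ h (polarization u c g (σ x)) := hp.integrable_comp_of_integrable hi'
  rw [integral_add hi' i2, integral_add hi i1] at e3
  linarith

/-- A continuous function whose second moment is not decreased by polarization is at least as large
on the near side of the hyperplane as at the reflected point. -/
lemma le_of_integral_norm_sq_mul_polarization (hu : ‖u‖ = 1) (hc : 0 < c) {g : V → ℝ}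
    (hg : Continuous g) (hi : Integrable fun x ↦ ‖x‖ ^ 2 * g x)
    (hi' : Integrable fun x ↦ ‖x‖ ^ 2 * polarization u c g x)
    (h : ∫ x, ‖x‖ ^ 2 * g x ≤ ∫ x, ‖x‖ ^ 2 * polarization u c g x) {x : V}
    (hx : inner ℝ u x < c) : g (hyperplaneReflection u c x) ≤ g x := by
  have hp := measurePreserving_hyperplaneReflection (c := c) hu
  have key := integral_comp_of_involutive hp continuous_hyperplaneReflection
    (hyperplaneReflection_involutive hu)
  have hsi : Integrable fun x ↦ ‖x‖ ^ 2 * g x - ‖x‖ ^ 2 * polarization u c g x := hi.sub hi'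
  have hsi' : Integrable fun x ↦ ‖σ x‖ ^ 2 * g (σ x) - ‖σ x‖ ^ 2 * polarization u c g (σ x) :=
    hp.integrable_comp_of_integrable hsi
  -- Summed over an orbit, the loss of second moment is either zero or the gap of squared norms
  -- times the gap of the exchanged values.
  have hnonneg : ∀ y, 0 ≤ (‖y‖ ^ 2 * g y - ‖y‖ ^ 2 * polarization u c g y)
      + (‖σ y‖ ^ 2 * g (σ y) - ‖σ y‖ ^ 2 * polarization u c g (σ y)) := by
    intro y
    rw [norm_hyperplaneReflection_sq hu]
    rcases le_total (inner ℝ u y) c with hy | hy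
    · rw [polarization_of_le hy, polarization_hyperplaneReflection_of_le hu hy]
      rcases le_total (g y) (g (σ y)) with h' | h'
      · rw [max_eq_right h', min_eq_left h']
        nlinarith [mul_nonneg (mul_nonneg hc.le (sub_nonneg.2 hy)) (sub_nonneg.2 h')]
      · rw [max_eq_left h', min_eq_right h']; simp
    · rw [polarization_of_ge hy, polarization_hyperplaneReflection_of_ge hu hy]
      rcases le_total (g y) (g (σ y)) with h' | h'
      · rw [max_eq_right h', min_eq_left h']; simp
      · rw [max_eq_left h', min_eq_right h']
        nlinarith [mul_nonneg (mul_nonneg hc.le (sub_nonneg.2 hy)) (sub_nonneg.2 h')]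
  have hint : ∫ y, ((‖y‖ ^ 2 * g y - ‖y‖ ^ 2 * polarization u c g y)
      + (‖σ y‖ ^ 2 * g (σ y) - ‖σ y‖ ^ 2 * polarization u c g (σ y))) = 0 := by
    apply le_antisymm _ (integral_nonneg hnonneg)
    rw [integral_add hsi hsi',
      key fun y ↦ ‖y‖ ^ 2 * g y - ‖y‖ ^ 2 * polarization u c g y, integral_sub hi hi']
    linarith
  have hcp := continuous_polarization (u := u) (c := c) hg
  have hcσ : Continuous σ := continuous_hyperplaneReflection
  -- A continuous function vanishing almost everywhere vanishes everywhere, so the orbit sum is zero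
  -- at the given `x`; a strict exchange there would make it positive.
  rw [integral_eq_zero_iff_of_nonneg hnonneg (hsi.add hsi')] at hint
  have hz := congrFun ((Continuous.ae_eq_iff_eq _ (by fun_prop) continuous_zero).1 hint) x
  simp only [Pi.zero_apply] at hz
  rw [norm_hyperplaneReflection_sq hu, polarization_of_le hx.le,
    polarization_hyperplaneReflection_of_le hu hx.le] at hz
  by_contra! hlt
  rw [max_eq_right hlt.le, min_eq_left hlt.le] at hz
  nlinarith [mul_pos (mul_pos hc (sub_pos.2 hx)) (sub_pos.2 hlt)]

/-- Polarization increases the energy with respect to a decreasing kernel. -/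
lemma integral_kernel_le_polarization (hu : ‖u‖ = 1) {g : V → ℝ} {k : ℝ → ℝ}
    (hk : AntitoneOn k (Ici 0))
    (hi : Integrable fun p : V × V ↦ k ‖p.1 - p.2‖ * (g p.1 * g p.2))
    (hi' : Integrable fun p : V × V ↦
      k ‖p.1 - p.2‖ * (polarization u c g p.1 * polarization u c g p.2)) :
    ∫ p : V × V, k ‖p.1 - p.2‖ * (g p.1 * g p.2) ≤
      ∫ p : V × V, k ‖p.1 - p.2‖ * (polarization u c g p.1 * polarization u c g p.2) := by
  have hcσ : Continuous σ := continuous_hyperplaneReflection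
  have hiσ : Function.Involutive σ := hyperplaneReflection_involutive hu
  have hp : MeasurePreserving σ volume volume := measurePreserving_hyperplaneReflection hu
  have hp1 : MeasurePreserving (Prod.map σ id : V × V → V × V) volume volume :=
    hp.prod (MeasurePreserving.id volume)
  have hp2 : MeasurePreserving (Prod.map id σ : V × V → V × V) volume volume :=
    (MeasurePreserving.id volume).prod hp
  have hp3 : MeasurePreserving (Prod.map σ σ : V × V → V × V) volume volume := hp.prod hp
  have q1 := integral_comp_of_involutive hp1 (hcσ.prodMap continuous_id)
    (fun p ↦ Prod.ext (hiσ p.1) rfl)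
  have q2 := integral_comp_of_involutive hp2 (continuous_id.prodMap hcσ)
    (fun p ↦ Prod.ext rfl (hiσ p.2))
  have q3 := integral_comp_of_involutive hp3 (hcσ.prodMap hcσ)
    (fun p ↦ Prod.ext (hiσ p.1) (hiσ p.2))
  -- Averaging over the four reflections of the pair `(x, y)` reduces the claim to a pointwise
  -- inequality in four values of `g`.
  have total : ∀ F : V × V → ℝ, Integrable F →
      Integrable (fun p ↦ (F p + F (Prod.map σ σ p)) + (F (Prod.map σ id p)
        + F (Prod.map id σ p))) ∧
      ∫ p, ((F p + F (Prod.map σ σ p)) + (F (Prod.map σ id p) + F (Prod.map id σ p)))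
        = 4 * ∫ p, F p := by
    intro F hF
    have i1 : Integrable fun p ↦ F (Prod.map σ id p) := hp1.integrable_comp_of_integrable hF
    have i2 : Integrable fun p ↦ F (Prod.map id σ p) := hp2.integrable_comp_of_integrable hF
    have i3 : Integrable fun p ↦ F (Prod.map σ σ p) := hp3.integrable_comp_of_integrable hF
    refine ⟨(hF.add i3).add (i1.add i2), ?_⟩
    rw [integral_add (f := fun p ↦ F p + F (Prod.map σ σ p))
      (g := fun p ↦ F (Prod.map σ id p) + F (Prod.map id σ p)) (hF.add i3) (i1.add i2),
      integral_add hF i3, integral_add i1 i2, q1, q2, q3]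
    ring
  obtain ⟨t1, t2⟩ := total _ hi
  obtain ⟨t1', t2'⟩ := total _ hi'
  suffices H : _ ≤ _ by
    have := integral_mono t1 t1' H
    rw [t2, t2'] at this
    linarith
  rintro ⟨x, y⟩
  simp only [Prod.map_apply, id]
  rw [norm_hyperplaneReflection_sub_hyperplaneReflection hu, norm_hyperplaneReflection_sub hu]
  have hsq := norm_sub_hyperplaneReflection_sq (c := c) hu x y
  have hle : ∀ {a b : V}, ‖a‖ ^ 2 ≤ ‖b‖ ^ 2 → k ‖b‖ ≤ k ‖a‖ := fun {a b} h ↦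
    hk (norm_nonneg _) (norm_nonneg _) ((sq_le_sq₀ (norm_nonneg _) (norm_nonneg _)).1 h)
  -- `A` weighs the pairs on the same side and `B` those on opposite sides. If `a, a'` and `b, b'`
  -- are ordered alike both sides are equal; otherwise the gain is `(A - B) * |a - a'| * |b - b'|`.
  have real_ineq : ∀ A B a a' b b' : ℝ, B ≤ A →
      A * (a * b) + A * (a' * b') + (B * (a' * b) + B * (a * b'))
      ≤ A * (max a a' * max b b') + A * (min a a' * min b b')
        + (B * (min a a' * max b b') + B * (max a a' * min b b')) := by
    intro A B a a' b b' hAB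
    rcases le_total a a' with h1 | h1 <;> rcases le_total b b' with h2 | h2 <;>
      simp only [max_eq_left, max_eq_right, min_eq_left, min_eq_right, h1, h2] <;>
      nlinarith [mul_nonneg (sub_nonneg.2 h1) (sub_nonneg.2 h2),
        mul_nonneg (sub_nonneg.2 hAB) (mul_nonneg (sub_nonneg.2 h1) (sub_nonneg.2 h2))]
  rcases le_total (inner ℝ u x) c with hx | hx <;> rcases le_total (inner ℝ u y) c with hy | hy
  · rw [polarization_hyperplaneReflection_of_le hu hx, polarization_of_le hx,
      polarization_hyperplaneReflection_of_le hu hy, polarization_of_le hy]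
    refine real_ineq _ _ _ _ _ _ (hle ?_)
    rw [hsq]; nlinarith [mul_nonneg (sub_nonneg.2 hx) (sub_nonneg.2 hy)]
  · rw [polarization_hyperplaneReflection_of_le hu hx, polarization_of_le hx,
      polarization_hyperplaneReflection_of_ge hu hy, polarization_of_ge hy]
    -- Here `σ y` is the point on the side of `x`, so `y` and `σ y` exchange roles, and so do the
    -- two kernel values.
    have h1 : k ‖x - y‖ ≤ k ‖x - σ y‖ := by
      apply hle; rw [hsq]; nlinarith [mul_nonneg (sub_nonneg.2 hx) (sub_nonneg.2 hy)]
    have := real_ineq _ _ (g x) (g (σ x)) (g (σ y)) (g y) h1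
    rw [max_comm (g (σ y)), min_comm (g (σ y))] at this
    linarith
  · rw [polarization_hyperplaneReflection_of_ge hu hx, polarization_of_ge hx,
      polarization_hyperplaneReflection_of_le hu hy, polarization_of_le hy]
    have h1 : k ‖x - y‖ ≤ k ‖x - σ y‖ := by
      apply hle; rw [hsq]; nlinarith [mul_nonneg (sub_nonneg.2 hx) (sub_nonneg.2 hy)]
    have := real_ineq _ _ (g x) (g (σ x)) (g (σ y)) (g y) h1
    rw [max_comm (g (σ y)), min_comm (g (σ y))] at this
    linarith
  · rw [polarization_hyperplaneReflection_of_ge hu hx, polarization_of_ge hx,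
      polarization_hyperplaneReflection_of_ge hu hy, polarization_of_ge hy]
    have h1 : k ‖x - σ y‖ ≤ k ‖x - y‖ := by
      apply hle; rw [hsq]; nlinarith [mul_nonneg (sub_nonneg.2 hx) (sub_nonneg.2 hy)]
    linarith [real_ineq _ _ (g x) (g (σ x)) (g y) (g (σ y)) h1]

end PolarizationIntegral

/-! ### Compactness of the competitors and the choice of hyperplanes -/

section Compactness

variable {V : Type*} [NormedAddCommGroup V]

/-- `g` takes values in `[0, M]`, vanishes outside the ball of radius `R`, and its modulus of
continuity is dominated by that of `f`. -/
def ModulusDominated (f : V → ℝ) (R M : ℝ) (g : V → ℝ) : Prop :=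
  (∀ x, 0 ≤ g x) ∧ (∀ x, g x ≤ M) ∧ (∀ x, R < ‖x‖ → g x = 0) ∧
    ∀ δ ε, (∀ x y, dist x y ≤ δ → |f x - f y| ≤ ε) → ∀ x y, dist x y ≤ δ → |g x - g y| ≤ ε

lemma ModulusDominated.exists_delta {f : V → ℝ} (hf : UniformContinuous f) (R M : ℝ) {ε : ℝ}
    (hε : 0 < ε) : ∃ δ > 0, ∀ g, ModulusDominated f R M g → ∀ x y, dist x y < δ →
      dist (g x) (g y) < ε := by
  obtain ⟨δ, hδ, h⟩ := Metric.uniformContinuous_iff.1 hf (ε / 2) (by positivity)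
  refine ⟨δ / 2, by positivity, fun g hg x y hxy ↦ ?_⟩
  have := hg.2.2.2 (δ / 2) (ε / 2) (fun x y hxy ↦ (h (by linarith)).le) x y hxy.le
  rw [Real.dist_eq]
  linarith

lemma ModulusDominated.continuous {f : V → ℝ} (hf : UniformContinuous f) {R M : ℝ} {g : V → ℝ}
    (hg : ModulusDominated f R M g) : Continuous g := by
  refine Metric.continuous_iff.2 fun x ε hε ↦ ?_
  obtain ⟨δ, hδ, h⟩ := ModulusDominated.exists_delta hf R M hε
  exact ⟨δ, hδ, fun y hy ↦ h g hg y x hy⟩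

/-- Arzelà-Ascoli: the conditions are closed under pointwise limits inside a product of intervals
`[0, M]`, and the common modulus of continuity gives equicontinuity. -/
lemma isCompact_modulusDominated {f : V → ℝ} (hf : UniformContinuous f) (R M : ℝ) :
    IsCompact {g : C(V, ℝ) | ModulusDominated f R M g} := by
  apply ArzelaAscoli.isCompact_of_equicontinuous
  · have himage : ContinuousMap.toFun '' {g : C(V, ℝ) | ModulusDominated f R M g}
        = {g | ModulusDominated f R M g} := by
      ext g
      exact ⟨by rintro ⟨g, hg, rfl⟩; exact hg, fun hg ↦ ⟨⟨g, hg.continuous hf⟩, hg, rfl⟩⟩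
    rw [himage]
    refine (isCompact_univ_pi fun _ : V ↦ isCompact_Icc (a := (0 : ℝ)) (b := M)).of_isClosed_subset
      ?_ fun g hg x _ ↦ ⟨hg.1 x, hg.2.1 x⟩
    simp only [ModulusDominated, ofPred_and, ofPred_forall]
    refine IsClosed.inter ?_ (IsClosed.inter ?_ (IsClosed.inter ?_ ?_))
    · exact isClosed_iInter fun x ↦ isClosed_le continuous_const (continuous_apply x)
    · exact isClosed_iInter fun x ↦ isClosed_le (continuous_apply x) continuous_const
    · exact isClosed_iInter fun x ↦ isClosed_iInter fun _ ↦
        isClosed_eq (continuous_apply x) continuous_const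
    · exact isClosed_iInter fun δ ↦ isClosed_iInter fun ε ↦ isClosed_iInter fun _ ↦
        isClosed_iInter fun x ↦ isClosed_iInter fun y ↦ isClosed_iInter fun _ ↦
          isClosed_le ((continuous_apply x).sub (continuous_apply y)).abs continuous_const
  · intro x
    refine Metric.equicontinuousAt_iff.2 fun ε hε ↦ ?_
    obtain ⟨δ, hδ, h⟩ := ModulusDominated.exists_delta hf R M hε
    exact ⟨δ, hδ, fun y hy g ↦ h g g.2 x y (by rwa [dist_comm])⟩

lemma ModulusDominated.eq_zero_of_notMem {f : V → ℝ} {R M : ℝ} {g : V → ℝ}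
    (hg : ModulusDominated f R M g) {x : V} (hx : x ∉ Metric.closedBall (0 : V) R) : g x = 0 :=
  hg.2.2.1 x (by simpa using hx)

lemma ModulusDominated.polarization [InnerProductSpace ℝ V] {f : V → ℝ} {R M : ℝ} {g : V → ℝ}
    (hg : ModulusDominated f R M g) {u : V} (hu : ‖u‖ = 1) {c : ℝ} (hc : 0 ≤ c) :
    ModulusDominated f R M (polarization u c g) :=
  ⟨polarization_nonneg hg.1, polarization_le hg.2.1,
    fun _ hx ↦ polarization_eq_zero hu hc hg.1 hg.2.2.1 hx,
    fun δ ε h _ _ hxy ↦ abs_polarization_sub_le hu (hg.2.2.2 δ ε h) hxy⟩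

/-- The hyperplane is the perpendicular bisector of `x` and `y`. The origin is strictly on the side
of `x`, being nearer to it, which makes `c` positive. -/
lemma exists_hyperplaneReflection_eq [InnerProductSpace ℝ V] {x y : V} (h : ‖x‖ < ‖y‖) :
    ∃ (u : V) (c : ℝ), ‖u‖ = 1 ∧ 0 < c ∧ inner ℝ u x < c ∧ hyperplaneReflection u c x = y := by
  have hne : y - x ≠ 0 := sub_ne_zero.2 fun hxy ↦ by simp [hxy] at h
  have hpos : 0 < ‖y - x‖ := norm_pos_iff.2 hne
  have hsq : inner ℝ (y - x) (y - x) = ‖y - x‖ ^ 2 := real_inner_self_eq_norm_sq _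
  have hin : inner ℝ (y - x) (x + y) = ‖y‖ ^ 2 - ‖x‖ ^ 2 := by
    rw [inner_sub_left, inner_add_right, inner_add_right, real_inner_self_eq_norm_sq,
      real_inner_self_eq_norm_sq, real_inner_comm]
    ring
  have hdiff : ‖y - x‖⁻¹ * (inner ℝ (y - x) (x + y) / 2)
      - ‖y - x‖⁻¹ * inner ℝ (y - x) x = ‖y - x‖ / 2 := by
    have : inner ℝ (y - x) (x + y) = inner ℝ (y - x) (y - x) + 2 * inner ℝ (y - x) x := by
      rw [inner_add_right, inner_sub_right]; ring
    rw [this, hsq]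
    field_simp
    ring
  refine ⟨‖y - x‖⁻¹ • (y - x), ‖y - x‖⁻¹ * (inner ℝ (y - x) (x + y) / 2), ?_, ?_, ?_, ?_⟩
  · rw [norm_smul, norm_inv, norm_norm, inv_mul_cancel₀ hpos.ne']
  · rw [hin]
    have : 0 < ‖y‖ ^ 2 - ‖x‖ ^ 2 := by nlinarith [norm_nonneg x]
    positivity
  · rw [real_inner_smul_left]
    linarith
  · rw [hyperplaneReflection, real_inner_smul_left, hdiff, smul_smul]
    have : 2 * (‖y - x‖ / 2) * ‖y - x‖⁻¹ = 1 := by field_simp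
    rw [this, one_smul, add_sub_cancel]

end Compactness

/-! ### Riesz's inequality by minimizing the second moment -/

section Rearrangement

variable {V : Type*} [NormedAddCommGroup V] [InnerProductSpace ℝ V] [FiniteDimensional ℝ V]
  [MeasurableSpace V] [BorelSpace V]

lemma integrable_of_eq_zero_of_notMem {X : Type*} [TopologicalSpace X] [MeasurableSpace X]
    [OpensMeasurableSpace X] [R1Space X] {μ : Measure X} [IsFiniteMeasureOnCompacts μ]
    {E : Type*} [NormedAddCommGroup E]
    {F : X → E} (hF : Continuous F) {K : Set X} (hK : IsCompact K) (h : ∀ x ∉ K, F x = 0) :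
    Integrable F μ :=
  hF.integrable_of_hasCompactSupport (HasCompactSupport.intro hK fun x hx ↦ h x hx)

/-- Two functions supported in a common ball, for which the integrals of all continuous functions
vanishing at the origin agree, are equimeasurable. -/
lemma measure_superlevel_eq {f g : V → ℝ} (hf : Continuous f) (hg : Continuous g) {R : ℝ}
    (hfR : ∀ x ∉ Metric.closedBall (0 : V) R, f x = 0)
    (hgR : ∀ x ∉ Metric.closedBall (0 : V) R, g x = 0)
    (h : ∀ b : ℝ → ℝ, Continuous b → b 0 = 0 →
      ∫ x in Metric.closedBall (0 : V) R, b (g x) = ∫ x in Metric.closedBall (0 : V) R, b (f x))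
    {t : ℝ} (ht : 0 < t) : volume {x | t < g x} = volume {x | t < f x} := by
  set B := Metric.closedBall (0 : V) R
  have hB : IsCompact B := isCompact_closedBall _ _
  have : IsFiniteMeasure (volume.restrict B : Measure V) :=
    ⟨by rw [Measure.restrict_apply_univ]; exact hB.measure_lt_top⟩
  have key : (volume.restrict B).map g = (volume.restrict B).map f := by
    apply ext_of_forall_integral_eq_of_IsFiniteMeasure
    intro b
    rw [integral_map hg.measurable.aemeasurable b.continuous.aestronglyMeasurable,
      integral_map hf.measurable.aemeasurable b.continuous.aestronglyMeasurable]
    -- Subtracting the constant `b 0` meets the condition at the origin; it integrates to the same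
    -- finite amount for both functions.
    have h1 := h (fun y ↦ b y - b 0) (by fun_prop) (by simp)
    rw [integral_sub _ (integrable_const _), integral_sub _ (integrable_const _)] at h1
    · linarith
    · exact (b.continuous.comp hf).continuousOn.integrableOn_compact hB
    · exact (b.continuous.comp hg).continuousOn.integrableOn_compact hB
  have level : ∀ {F : V → ℝ}, Continuous F → (∀ x ∉ B, F x = 0) →
      volume {x | t < F x} = (volume.restrict B).map F (Ioi t) := by
    intro F hF hFR
    rw [Measure.map_apply hF.measurable measurableSet_Ioi, Measure.restrict_apply
      (hF.measurable measurableSet_Ioi)]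
    congr 1
    ext x
    refine ⟨fun hx ↦ ⟨hx, ?_⟩, fun hx ↦ hx.1⟩
    by_contra hxB
    rw [mem_ofPred_eq, hFR x hxB] at hx
    exact ht.not_gt hx
  rw [level hg hgR, level hf hfR, key]

/-- A nonnegative continuous compactly supported function has a continuous, radially decreasing,
equimeasurable rearrangement with at least the same energy. -/
theorem exists_radial_rearrangement {f : V → ℝ} (hf : Continuous f) (hfc : HasCompactSupport f)
    (hf0 : ∀ x, 0 ≤ f x) {k : ℝ → ℝ} (hk : Continuous k) (hka : AntitoneOn k (Ici 0)) :
    ∃ g : V → ℝ, Continuous g ∧ HasCompactSupport g ∧ (∀ x, 0 ≤ g x) ∧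
      (∀ x y, ‖x‖ < ‖y‖ → g y ≤ g x) ∧
      (∀ t > 0, volume {x | t < g x} = volume {x | t < f x}) ∧
      ∫ p : V × V, k ‖p.1 - p.2‖ * (f p.1 * f p.2) ≤
        ∫ p : V × V, k ‖p.1 - p.2‖ * (g p.1 * g p.2) := by
  obtain ⟨R, hR⟩ : ∃ R, ∀ x, R < ‖x‖ → f x = 0 := by
    obtain ⟨R, hR⟩ := hfc.isCompact.isBounded.subset_closedBall (0 : V)
    refine ⟨R, fun x hx ↦ ?_⟩
    by_contra hne
    have := hR (subset_tsupport f hne)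
    rw [mem_closedBall_zero_iff] at this
    linarith
  obtain ⟨M, hM⟩ : ∃ M, ∀ x, f x ≤ M := by
    obtain ⟨M, hM⟩ := hfc.exists_bound_of_continuous hf
    exact ⟨M, fun x ↦ (le_abs_self _).trans (hM x)⟩
  have hfu : UniformContinuous f := hfc.uniformContinuous_of_continuous hf
  set B := Metric.closedBall (0 : V) R
  have hB : IsCompact B := isCompact_closedBall _ _
  have hBB : IsCompact (B ×ˢ B) := hB.prod hB
  let S : Set C(V, ℝ) := {g | ModulusDominated f R M g}
  have hS : IsCompact S := isCompact_modulusDominated hfu R M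
  have : CompactSpace S := isCompact_iff_compactSpace.1 hS
  have hev : Continuous fun q : S × V ↦ q.1.1 q.2 := by fun_prop
  have hev1 : Continuous fun q : S × (V × V) ↦ q.1.1 q.2.1 := by fun_prop
  have hev2 : Continuous fun q : S × (V × V) ↦ q.1.1 q.2.2 := by fun_prop
  -- Equimeasurability is encoded by integrals of continuous `b`, so that it is a closed condition.
  -- Requiring `b 0 = 0` makes `b ∘ g` vanish off the ball.
  let T : Set S := {g | (∀ b : ℝ → ℝ, Continuous b → b 0 = 0 →
      ∫ x in B, b (g.1 x) = ∫ x in B, b (f x)) ∧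
    ∫ p in B ×ˢ B, k ‖p.1 - p.2‖ * (f p.1 * f p.2) ≤
      ∫ p in B ×ˢ B, k ‖p.1 - p.2‖ * (g.1 p.1 * g.1 p.2)}
  have hTc : IsClosed T := by
    simp only [T, ofPred_and, ofPred_forall]
    refine IsClosed.inter (isClosed_iInter fun b ↦ isClosed_iInter fun hb ↦ isClosed_iInter
      fun _ ↦ isClosed_eq ?_ continuous_const) (isClosed_le continuous_const ?_)
    · exact continuous_parametric_integral_of_continuous
        (f := fun (g : S) x ↦ b (g.1 x)) (hb.comp hev) hB
    · apply continuous_parametric_integral_of_continuous _ hBB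
      have : Continuous fun q : S × (V × V) ↦ k ‖q.2.1 - q.2.2‖ := by fun_prop
      exact this.mul (hev1.mul hev2)
  have hfS : ModulusDominated f R M f := ⟨hf0, hM, hR, fun _ _ h ↦ h⟩
  have hTn : T.Nonempty := ⟨⟨⟨f, hf⟩, hfS⟩, fun _ _ _ ↦ rfl, le_rfl⟩
  have hMc : Continuous fun g : S ↦ ∫ x in B, ‖x‖ ^ 2 * g.1 x := by
    apply continuous_parametric_integral_of_continuous _ hB
    have : Continuous fun q : S × V ↦ ‖q.2‖ ^ 2 := by fun_prop
    exact this.mul hev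
  obtain ⟨⟨g, hgS⟩, ⟨hgT1, hgT2⟩, hgmin⟩ := hTc.isCompact.exists_isMinOn hTn hMc.continuousOn
  replace hgS : ModulusDominated f R M g := hgS
  simp only at hgT1 hgT2
  have set_eq : ∀ {F : V → ℝ}, (∀ x ∉ B, F x = 0) → ∫ x in B, F x = ∫ x, F x :=
    fun h ↦ setIntegral_eq_integral_of_forall_compl_eq_zero h
  have prod_zero : ∀ {h : V → ℝ}, ModulusDominated f R M h →
      ∀ p ∉ B ×ˢ B, k ‖p.1 - p.2‖ * (h p.1 * h p.2) = 0 := by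
    intro h hh p hp
    rw [mem_prod, not_and_or] at hp
    rcases hp with hp | hp <;> simp [hh.eq_zero_of_notMem hp]
  have prod_int : ∀ {h : V → ℝ}, ModulusDominated f R M h →
      Integrable fun p : V × V ↦ k ‖p.1 - p.2‖ * (h p.1 * h p.2) := by
    intro h hh
    have := hh.continuous hfu
    exact integrable_of_eq_zero_of_notMem (by fun_prop) hBB (prod_zero hh)
  have mom_zero : ∀ {h : V → ℝ}, ModulusDominated f R M h → ∀ x ∉ B, ‖x‖ ^ 2 * h x = 0 :=
    fun hh x hx ↦ by simp [hh.eq_zero_of_notMem hx]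
  have mom_int : ∀ {h : V → ℝ}, ModulusDominated f R M h →
      Integrable fun x ↦ ‖x‖ ^ 2 * h x := by
    intro h hh
    have := hh.continuous hfu
    exact integrable_of_eq_zero_of_notMem (by fun_prop) hB (mom_zero hh)
  refine ⟨g, g.continuous, HasCompactSupport.intro hB fun x hx ↦ hgS.eq_zero_of_notMem hx, hgS.1,
    ?_, fun t ht ↦ measure_superlevel_eq hf g.continuous (fun x hx ↦ hfS.eq_zero_of_notMem hx)
      (fun x hx ↦ hgS.eq_zero_of_notMem hx) hgT1 ht, ?_⟩
  · intro x y hxy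
    obtain ⟨u, c, hu, hc, hx, rfl⟩ := exists_hyperplaneReflection_eq hxy
    have hpS : ModulusDominated f R M (polarization u c g) := hgS.polarization hu hc.le
    refine le_of_integral_norm_sq_mul_polarization hu hc g.continuous (mom_int hgS) (mom_int hpS)
      ?_ hx
    -- The polarized minimizer is again admissible, so its second moment is no smaller, and this
    -- forces the order of the two values.
    have hpT : (⟨⟨polarization u c g, hpS.continuous hfu⟩, hpS⟩ : S) ∈ T := by
      refine ⟨fun b hb hb0 ↦ ?_, ?_⟩
      · rw [← hgT1 b hb hb0]
        have z : ∀ {h : V → ℝ}, ModulusDominated f R M h → ∀ x ∉ B, b (h x) = 0 :=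
          fun hh x hx ↦ by rw [hh.eq_zero_of_notMem hx, hb0]
        have i : ∀ {h : V → ℝ}, ModulusDominated f R M h → Integrable fun x ↦ b (h x) :=
          fun hh ↦ integrable_of_eq_zero_of_notMem (hb.comp (hh.continuous hfu)) hB (z hh)
        rw [set_eq (z hgS)]
        exact (set_eq (z hpS)).trans (integral_comp_polarization hu (i hgS) (i hpS))
      · refine hgT2.trans ?_
        rw [setIntegral_eq_integral_of_forall_compl_eq_zero (prod_zero hgS)]
        refine (integral_kernel_le_polarization hu hka (prod_int hgS) (prod_int hpS)).trans_eq ?_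
        exact (setIntegral_eq_integral_of_forall_compl_eq_zero (prod_zero hpS)).symm
    have := hgmin hpT
    simp only [mem_ofPred_eq] at this
    rw [set_eq (mom_zero hgS)] at this
    exact this.trans_eq (set_eq (mom_zero hpS))
  · rw [setIntegral_eq_integral_of_forall_compl_eq_zero (prod_zero hgS),
      setIntegral_eq_integral_of_forall_compl_eq_zero (prod_zero hfS)] at hgT2
    exact hgT2

end Rearrangement

/-! ### Layer-cake formulas -/

section LayerCake

lemma lintegral_Ioi_indicator_superlevel {X : Type*} (F : X → ℝ) (x : X) :
    ∫⁻ t in Ioi (0 : ℝ), {y | t < F y}.indicator (fun _ ↦ (1 : ℝ≥0∞)) x = ENNReal.ofReal (F x) := by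
  have : (fun t : ℝ ↦ {y | t < F y}.indicator (fun _ ↦ (1 : ℝ≥0∞)) x)
      = (Iio (F x)).indicator 1 := by
    ext t; simp [indicator]
  rw [this, lintegral_indicator_one measurableSet_Iio, Measure.restrict_apply measurableSet_Iio,
    Iio_inter_Ioi, Real.volume_Ioo, sub_zero]

lemma lintegral_mul_lintegral_indicator {X : Type*} [MeasurableSpace X] {μ : Measure X}
    [SFinite μ] {A B : ℝ → Set X} (hA : MeasurableSet {p : X × ℝ | p.1 ∈ A p.2})
    (hB : MeasurableSet {p : X × ℝ | p.1 ∈ B p.2}) :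
    ∫⁻ x, (∫⁻ s in Ioi (0 : ℝ), (A s).indicator (fun _ ↦ (1 : ℝ≥0∞)) x)
        * (∫⁻ t in Ioi (0 : ℝ), (B t).indicator (fun _ ↦ (1 : ℝ≥0∞)) x) ∂μ
      = ∫⁻ s in Ioi (0 : ℝ), ∫⁻ t in Ioi (0 : ℝ), μ (A s ∩ B t) := by
  classical
  have mA : Measurable fun p : X × ℝ ↦ (A p.2).indicator (fun _ ↦ (1 : ℝ≥0∞)) p.1 :=
    Measurable.ite hA measurable_const measurable_const
  have mB : Measurable fun p : X × ℝ ↦ (B p.2).indicator (fun _ ↦ (1 : ℝ≥0∞)) p.1 :=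
    Measurable.ite hB measurable_const measurable_const
  have mF : Measurable fun p : (X × ℝ) × ℝ ↦ (A p.1.2).indicator (fun _ ↦ (1 : ℝ≥0∞)) p.1.1
      * (B p.2).indicator (fun _ ↦ (1 : ℝ≥0∞)) p.1.1 := by
    refine (mA.comp measurable_fst).mul (mB.comp (f := fun p : (X × ℝ) × ℝ ↦ (p.1.1, p.2)) ?_)
    fun_prop
  calc
    _ = ∫⁻ x, (∫⁻ s in Ioi (0 : ℝ), ∫⁻ t in Ioi (0 : ℝ),
          (A s).indicator (fun _ ↦ (1 : ℝ≥0∞)) x * (B t).indicator (fun _ ↦ (1 : ℝ≥0∞)) x) ∂μ := by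
        congr 1 with x
        have m1 : Measurable fun s ↦ (A s).indicator (fun _ ↦ (1 : ℝ≥0∞)) x :=
          mA.comp measurable_prodMk_left
        have m2 : Measurable fun t ↦ (B t).indicator (fun _ ↦ (1 : ℝ≥0∞)) x :=
          mB.comp measurable_prodMk_left
        simp_rw [lintegral_const_mul _ m2, lintegral_mul_const _ m1]
    _ = ∫⁻ s in Ioi (0 : ℝ), ∫⁻ x, (∫⁻ t in Ioi (0 : ℝ),
          (A s).indicator (fun _ ↦ (1 : ℝ≥0∞)) x * (B t).indicator (fun _ ↦ (1 : ℝ≥0∞)) x) ∂μ :=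
        lintegral_lintegral_swap mF.lintegral_prod_right'.aemeasurable
    _ = _ := by
        congr 1 with s
        rw [lintegral_lintegral_swap]
        · congr 1 with t
          have e : (fun x ↦ (A s).indicator (fun _ ↦ (1 : ℝ≥0∞)) x
              * (B t).indicator (fun _ ↦ (1 : ℝ≥0∞)) x) = (A s ∩ B t).indicator 1 := by
            ext x
            by_cases h1 : x ∈ A s <;> by_cases h2 : x ∈ B t <;> simp [h1, h2]
          have m1 : MeasurableSet (A s) := hA.preimage (f := fun x ↦ (x, s)) (by fun_prop)
          have m2 : MeasurableSet (B t) := hB.preimage (f := fun x ↦ (x, t)) (by fun_prop)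
          rw [e, lintegral_indicator_one (m1.inter m2)]
        · exact (mF.comp (g := _)
            (f := fun p : X × ℝ ↦ ((p.1, s), p.2)) (by fun_prop)).aemeasurable

end LayerCake

/-! ### Symmetric decreasing rearrangement on `L²` -/

section SymmRearr

variable {d : ℕ}

local notation "E" => EuclideanSpace ℝ (Fin d)

lemma symmRearr_congr_measure {φ ψ : E → ℂ}
    (h : ∀ t > 0, volume {y | t < ‖φ y‖} = volume {y | t < ‖ψ y‖}) :
    symmRearr φ = symmRearr ψ := by
  ext x
  refine setLIntegral_congr_fun measurableSet_Ioi fun t ht ↦ ?_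
  simp only [symmRearrSet, measureReal_def, h t ht]

lemma symmRearr_congr_ae {φ ψ : E → ℂ} (h : φ =ᵐ[volume] ψ) : symmRearr φ = symmRearr ψ := by
  refine symmRearr_congr_measure fun t _ ↦ measure_congr ?_
  filter_upwards [h] with x hx
  exact propext (by change t < ‖φ x‖ ↔ t < ‖ψ x‖; rw [hx])

lemma volume_ball_zero (hd : 1 ≤ d) {r : ℝ} (hr : 0 ≤ r) :
    volume (Metric.ball (0 : E) r) = ENNReal.ofReal (r ^ d) * volume (Metric.ball (0 : E) 1) := by
  have : Nonempty (Fin d) := ⟨⟨0, hd⟩⟩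
  rw [Measure.addHaar_ball _ _ hr, finrank_euclideanSpace_fin]

lemma volume_symmRearrSet (hd : 1 ≤ d) {A : Set E} (hA : volume A ≠ ∞) :
    volume (symmRearrSet A) = volume A := by
  have h1 : volume (Metric.ball (0 : E) 1) ≠ 0 := (Metric.measure_ball_pos _ _ one_pos).ne'
  have h2 : volume (Metric.ball (0 : E) 1) ≠ ∞ := measure_ball_lt_top.ne
  have h3 : 0 ≤ volume.real A / volume.real (Metric.ball (0 : E) 1) := by positivity
  rw [symmRearrSet, volume_ball_zero hd (by positivity), ← Real.rpow_natCast, ← Real.rpow_mul h3,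
    one_div_mul_cancel (by positivity), Real.rpow_one, measureReal_def, measureReal_def,
    ← ENNReal.toReal_div, ENNReal.ofReal_toReal (ENNReal.div_ne_top hA h1),
    ENNReal.div_mul_cancel h1 h2]

lemma symmRearrSet_eq_ball (hd : 1 ≤ d) {A : Set E} {r : ℝ} (hr : 0 ≤ r)
    (hA : volume A = volume (Metric.ball (0 : E) r)) : symmRearrSet A = Metric.ball 0 r := by
  have h1 : volume.real (Metric.ball (0 : E) 1) ≠ 0 :=
    (ENNReal.toReal_pos (Metric.measure_ball_pos _ _ one_pos).ne' measure_ball_lt_top.ne).ne'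
  have h2 : volume.real A = r ^ d * volume.real (Metric.ball (0 : E) 1) := by
    rw [measureReal_def, hA, volume_ball_zero hd hr, ENNReal.toReal_mul,
      ENNReal.toReal_ofReal (by positivity), measureReal_def]
  rw [symmRearrSet, h2, mul_div_cancel_right₀ _ h1, ← Real.rpow_natCast, ← Real.rpow_mul hr,
    mul_one_div_cancel (by positivity), Real.rpow_one]

lemma volume_symmRearrSet_inter (hd : 1 ≤ d) {A B : Set E} (hA : volume A ≠ ∞)
    (hB : volume B ≠ ∞) :
    volume (symmRearrSet A ∩ symmRearrSet B) = min (volume A) (volume B) := by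
  rw [← volume_symmRearrSet hd hA, ← volume_symmRearrSet hd hB]
  rcases le_total ((volume.real A / volume.real (Metric.ball (0 : E) 1)) ^ (1 / (d : ℝ)))
    ((volume.real B / volume.real (Metric.ball (0 : E) 1)) ^ (1 / (d : ℝ))) with h | h
  · have hsub : symmRearrSet A ⊆ symmRearrSet B := Metric.ball_subset_ball h
    rw [inter_eq_left.2 hsub, min_eq_left (measure_mono hsub)]
  · have hsub : symmRearrSet B ⊆ symmRearrSet A := Metric.ball_subset_ball h
    rw [inter_eq_right.2 hsub, min_eq_right (measure_mono hsub)]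

/-- The volume of a superlevel set is antitone in the level, so the radius is measurable in it;
joint measurability is what Tonelli requires. -/
lemma measurableSet_symmRearrSet_superlevel (φ : E → ℂ) :
    MeasurableSet {p : E × ℝ | p.1 ∈ symmRearrSet {y | p.2 < ‖φ y‖}} := by
  have hanti : Antitone fun s : ℝ ↦ volume {y | s < ‖φ y‖} :=
    fun s t hst ↦ measure_mono fun y (hy : t < ‖φ y‖) ↦ hst.trans_lt hy
  have hm : Measurable fun s : ℝ ↦ volume.real {y | s < ‖φ y‖} := hanti.measurable.ennreal_toReal
  simp only [symmRearrSet, mem_ball_zero_iff]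
  exact measurableSet_lt (by fun_prop)
    (((hm.comp measurable_snd).div_const _).pow_const _)

lemma measurable_symmRearr (φ : E → ℂ) : Measurable (symmRearr φ) := by
  classical
  have mA : Measurable fun p : E × ℝ ↦
      (symmRearrSet {y | p.2 < ‖φ y‖}).indicator (fun _ ↦ (1 : ℝ≥0∞)) p.1 :=
    Measurable.ite (measurableSet_symmRearrSet_superlevel φ) measurable_const measurable_const
  exact mA.lintegral_prod_right'

lemma measurable_symmRearrC (φ : E → ℂ) : Measurable (symmRearrC φ) :=
  Complex.measurable_ofReal.comp (measurable_symmRearr φ).ennreal_toReal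

lemma lintegral_symmRearr_mul (φ ψ : E → ℂ) :
    ∫⁻ x, symmRearr φ x * symmRearr ψ x
      = ∫⁻ s in Ioi (0 : ℝ), ∫⁻ t in Ioi (0 : ℝ),
        volume (symmRearrSet {y | s < ‖φ y‖} ∩ symmRearrSet {y | t < ‖ψ y‖}) :=
  lintegral_mul_lintegral_indicator (measurableSet_symmRearrSet_superlevel φ)
    (measurableSet_symmRearrSet_superlevel ψ)

lemma lintegral_enorm_mul_enorm {φ ψ : E → ℂ} (hφ : Measurable φ) (hψ : Measurable ψ) :
    ∫⁻ x, ‖φ x‖ₑ * ‖ψ x‖ₑ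
      = ∫⁻ s in Ioi (0 : ℝ), ∫⁻ t in Ioi (0 : ℝ), volume ({y | s < ‖φ y‖} ∩ {y | t < ‖ψ y‖}) := by
  rw [← lintegral_mul_lintegral_indicator (A := fun s ↦ {y | s < ‖φ y‖})
    (B := fun s ↦ {y | s < ‖ψ y‖}) (measurableSet_lt measurable_snd (hφ.comp measurable_fst).norm)
    (measurableSet_lt measurable_snd (hψ.comp measurable_fst).norm)]
  congr 1 with x
  rw [lintegral_Ioi_indicator_superlevel, lintegral_Ioi_indicator_superlevel, ofReal_norm,
    ofReal_norm]

lemma volume_superlevel_ne_top {φ : E → ℂ} (hφ : MemLp φ 2 volume) {t : ℝ} (ht : 0 < t) :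
    volume {y | t < ‖φ y‖} ≠ ∞ := by
  have h := hφ.meas_ge_lt_top' (by norm_num) (by norm_num) (ε := ENNReal.ofReal t) (by simpa)
  refine ((measure_mono fun y (hy : t < ‖φ y‖) ↦ ?_).trans_lt h).ne
  change ENNReal.ofReal t ≤ ‖φ y‖ₑ
  rw [← ofReal_norm]
  exact ENNReal.ofReal_le_ofReal hy.le

/-- The Hardy-Littlewood rearrangement inequality. -/
lemma lintegral_enorm_mul_enorm_le (hd : 1 ≤ d) {φ ψ : E → ℂ} (hφ : Measurable φ)
    (hψ : Measurable ψ) (hφ2 : MemLp φ 2 volume) (hψ2 : MemLp ψ 2 volume) :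
    ∫⁻ x, ‖φ x‖ₑ * ‖ψ x‖ₑ ≤ ∫⁻ x, symmRearr φ x * symmRearr ψ x := by
  rw [lintegral_enorm_mul_enorm hφ hψ, lintegral_symmRearr_mul]
  refine setLIntegral_mono' measurableSet_Ioi fun s hs ↦
    setLIntegral_mono' measurableSet_Ioi fun t ht ↦ ?_
  rw [volume_symmRearrSet_inter hd (volume_superlevel_ne_top hφ2 hs)
    (volume_superlevel_ne_top hψ2 ht)]
  exact le_min (measure_mono inter_subset_left) (measure_mono inter_subset_right)

/-- The superlevel sets of a single function are nested, as are the balls, so the Hardy-Littlewood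
comparison of intersections becomes an equality. -/
lemma lintegral_symmRearr_sq (hd : 1 ≤ d) {φ : E → ℂ} (hφ : Measurable φ)
    (hφ2 : MemLp φ 2 volume) : ∫⁻ x, symmRearr φ x ^ 2 = ∫⁻ x, ‖φ x‖ₑ ^ 2 := by
  simp_rw [sq]
  rw [lintegral_enorm_mul_enorm hφ hφ, lintegral_symmRearr_mul]
  refine setLIntegral_congr_fun measurableSet_Ioi fun s hs ↦
    setLIntegral_congr_fun measurableSet_Ioi fun t ht ↦ ?_
  rw [volume_symmRearrSet_inter hd (volume_superlevel_ne_top hφ2 hs)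
    (volume_superlevel_ne_top hφ2 ht)]
  rcases le_total s t with h | h
  · have hsub : {y | t < ‖φ y‖} ⊆ {y | s < ‖φ y‖} := fun y (hy : t < ‖φ y‖) ↦ h.trans_lt hy
    rw [inter_eq_right.2 hsub, min_eq_right (measure_mono hsub)]
  · have hsub : {y | s < ‖φ y‖} ⊆ {y | t < ‖φ y‖} := fun y (hy : s < ‖φ y‖) ↦ h.trans_lt hy
    rw [inter_eq_left.2 hsub, min_eq_left (measure_mono hsub)]

lemma eLpNorm_two_eq_lintegral {X F : Type*} [MeasurableSpace X] [NormedAddCommGroup F]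
    (f : X → F) (μ : Measure X) : eLpNorm f 2 μ = (∫⁻ x, ‖f x‖ₑ ^ 2 ∂μ) ^ (1 / 2 : ℝ) := by
  rw [eLpNorm_eq_lintegral_rpow_enorm_toReal (by norm_num) (by norm_num)]
  simp

lemma lintegral_enorm_sq_lt_top {X F : Type*} [MeasurableSpace X] [NormedAddCommGroup F]
    {f : X → F} {μ : Measure X} (hf : MemLp f 2 μ) : ∫⁻ x, ‖f x‖ₑ ^ 2 ∂μ < ∞ := by
  have := hf.2
  rw [eLpNorm_two_eq_lintegral] at this
  exact (ENNReal.rpow_lt_top_iff_of_pos (by norm_num)).1 this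

lemma symmRearr_ae_lt_top (hd : 1 ≤ d) {φ : E → ℂ} (hφ : Measurable φ)
    (hφ2 : MemLp φ 2 volume) : ∀ᵐ x, symmRearr φ x < ∞ := by
  have h : ∫⁻ x, symmRearr φ x ^ 2 ≠ ∞ := by
    rw [lintegral_symmRearr_sq hd hφ hφ2]; exact (lintegral_enorm_sq_lt_top hφ2).ne
  filter_upwards [ae_lt_top ((measurable_symmRearr φ).pow_const 2) h] with x hx
  exact (ENNReal.pow_lt_top_iff.1 hx).resolve_right (by norm_num)

lemma enorm_symmRearrC_ae_eq (hd : 1 ≤ d) {φ : E → ℂ} (hφ : Measurable φ)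
    (hφ2 : MemLp φ 2 volume) : ∀ᵐ x, ‖symmRearrC φ x‖ₑ = symmRearr φ x := by
  filter_upwards [symmRearr_ae_lt_top hd hφ hφ2] with x hx
  rw [symmRearrC, ← ofReal_norm, Complex.norm_real, Real.norm_of_nonneg ENNReal.toReal_nonneg,
    ENNReal.ofReal_toReal hx.ne]

lemma symmRearrC_congr_ae {φ ψ : E → ℂ} (h : φ =ᵐ[volume] ψ) : symmRearrC φ = symmRearrC ψ := by
  ext x
  rw [symmRearrC, symmRearrC, symmRearr_congr_ae h]

lemma memLp_symmRearrC (hd : 1 ≤ d) {φ : E → ℂ} (hφ2 : MemLp φ 2 volume) :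
    MemLp (symmRearrC φ) 2 volume := by
  obtain ⟨φ', hm, hae⟩ := hφ2.1
  rw [symmRearrC_congr_ae hae]
  replace hφ2 := (memLp_congr_ae hae).1 hφ2
  refine ⟨(measurable_symmRearrC φ').aestronglyMeasurable, ?_⟩
  rw [eLpNorm_two_eq_lintegral]
  refine ENNReal.rpow_lt_top_of_nonneg (by norm_num) (ne_of_lt ?_)
  calc
    _ = ∫⁻ x, symmRearr φ' x ^ 2 := by
      refine lintegral_congr_ae ?_
      filter_upwards [enorm_symmRearrC_ae_eq hd hm.measurable hφ2] with x hx
      rw [hx]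
    _ = ∫⁻ x, ‖φ' x‖ₑ ^ 2 := lintegral_symmRearr_sq hd hm.measurable hφ2
    _ < ∞ := lintegral_enorm_sq_lt_top hφ2

lemma enorm_sub_sq_add {p q : ℝ} (hp : 0 ≤ p) (hq : 0 ≤ q) :
    ‖p - q‖ₑ ^ 2 + 2 * (‖p‖ₑ * ‖q‖ₑ) = ‖p‖ₑ ^ 2 + ‖q‖ₑ ^ 2 := by
  have h2 : (2 : ℝ≥0∞) = ENNReal.ofReal 2 := by simp
  rw [← ofReal_norm, ← ofReal_norm, ← ofReal_norm, h2, Real.norm_of_nonneg hp,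
    Real.norm_of_nonneg hq, ← ENNReal.ofReal_pow (norm_nonneg _), ← ENNReal.ofReal_pow hp,
    ← ENNReal.ofReal_pow hq, ← ENNReal.ofReal_mul hp, ← ENNReal.ofReal_mul (by norm_num),
    ← ENNReal.ofReal_add (by positivity) (by positivity),
    ← ENNReal.ofReal_add (by positivity) (by positivity), Real.norm_eq_abs, sq_abs]
  congr 1
  ring

lemma lintegral_enorm_norm_sub_sq_add {X F : Type*} [MeasurableSpace X] [NormedAddCommGroup F]
    [MeasurableSpace F] [OpensMeasurableSpace F] {μ : Measure X} {f g : X → F}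
    (hf : Measurable f) (hg : Measurable g) :
    ∫⁻ x, ‖‖f x‖ - ‖g x‖‖ₑ ^ 2 ∂μ + 2 * ∫⁻ x, ‖f x‖ₑ * ‖g x‖ₑ ∂μ
      = ∫⁻ x, ‖f x‖ₑ ^ 2 ∂μ + ∫⁻ x, ‖g x‖ₑ ^ 2 ∂μ := by
  rw [← lintegral_const_mul _ (by fun_prop), ← lintegral_add_left (by fun_prop),
    ← lintegral_add_left (by fun_prop)]
  congr 1 with x
  simpa using enorm_sub_sq_add (norm_nonneg (f x)) (norm_nonneg (g x))

/-- Symmetric decreasing rearrangement is nonexpansive on `L²`. -/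
theorem eLpNorm_symmRearrC_sub_le (hd : 1 ≤ d) {φ ψ : E → ℂ} (hφ2 : MemLp φ 2 volume)
    (hψ2 : MemLp ψ 2 volume) :
    eLpNorm (symmRearrC φ - symmRearrC ψ) 2 volume ≤ eLpNorm (φ - ψ) 2 volume := by
  obtain ⟨φ', hφm, hφ⟩ := hφ2.1
  obtain ⟨ψ', hψm, hψ⟩ := hψ2.1
  rw [symmRearrC_congr_ae hφ, symmRearrC_congr_ae hψ, eLpNorm_congr_ae (hφ.sub hψ)]
  replace hφ2 := (memLp_congr_ae hφ).1 hφ2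
  replace hψ2 := (memLp_congr_ae hψ).1 hψ2
  replace hφm := hφm.measurable
  replace hψm := hψm.measurable
  have hφr := enorm_symmRearrC_ae_eq hd hφm hφ2
  have hψr := enorm_symmRearrC_ae_eq hd hψm hψ2
  have e1 := lintegral_enorm_norm_sub_sq_add (μ := volume) (measurable_symmRearrC φ')
    (measurable_symmRearrC ψ')
  have e2 := lintegral_enorm_norm_sub_sq_add (μ := volume) hφm hψm
  have s1 : ∫⁻ x, ‖symmRearrC φ' x‖ₑ ^ 2 = ∫⁻ x, ‖φ' x‖ₑ ^ 2 := by
    rw [← lintegral_symmRearr_sq hd hφm hφ2]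
    exact lintegral_congr_ae (by filter_upwards [hφr] with x hx; rw [hx])
  have s2 : ∫⁻ x, ‖symmRearrC ψ' x‖ₑ ^ 2 = ∫⁻ x, ‖ψ' x‖ₑ ^ 2 := by
    rw [← lintegral_symmRearr_sq hd hψm hψ2]
    exact lintegral_congr_ae (by filter_upwards [hψr] with x hx; rw [hx])
  -- Expanding the squares, the norms are preserved and only the cross term changes; by
  -- Hardy-Littlewood it grows, so the distance shrinks.
  have s3 : ∫⁻ x, ‖φ' x‖ₑ * ‖ψ' x‖ₑ ≤ ∫⁻ x, ‖symmRearrC φ' x‖ₑ * ‖symmRearrC ψ' x‖ₑ := by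
    refine (lintegral_enorm_mul_enorm_le hd hφm hψm hφ2 hψ2).trans_eq ?_
    exact lintegral_congr_ae (by filter_upwards [hφr, hψr] with x hx hy; rw [hx, hy])
  rw [s1, s2, ← e2] at e1
  have fin : 2 * ∫⁻ x, ‖symmRearrC φ' x‖ₑ * ‖symmRearrC ψ' x‖ₑ ≠ ∞ := by
    refine ((le_add_self.trans_eq (e1.trans e2)).trans_lt ?_).ne
    exact ENNReal.add_lt_top.2 ⟨lintegral_enorm_sq_lt_top hφ2, lintegral_enorm_sq_lt_top hψ2⟩
  have key : ∫⁻ x, ‖‖symmRearrC φ' x‖ - ‖symmRearrC ψ' x‖‖ₑ ^ 2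
      ≤ ∫⁻ x, ‖‖φ' x‖ - ‖ψ' x‖‖ₑ ^ 2 := by
    refine (ENNReal.add_le_add_iff_right fin).1 ?_
    rw [e1]
    gcongr
  rw [eLpNorm_two_eq_lintegral, eLpNorm_two_eq_lintegral]
  refine ENNReal.rpow_le_rpow ?_ (by norm_num)
  calc
    _ = ∫⁻ x, ‖‖symmRearrC φ' x‖ - ‖symmRearrC ψ' x‖‖ₑ ^ 2 := by
      congr 1 with x
      congr 1
      simp only [symmRearrC, Pi.sub_apply, Complex.norm_real,
        Real.norm_of_nonneg ENNReal.toReal_nonneg]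
      rw [← Complex.ofReal_sub, ← ofReal_norm, ← ofReal_norm, Complex.norm_real]
    _ ≤ _ := key
    _ ≤ _ := by
      refine lintegral_mono fun x ↦ ?_
      gcongr
      rw [← ofReal_norm, ← ofReal_norm]
      exact ENNReal.ofReal_le_ofReal (abs_norm_sub_norm_le _ _)

/-- The radius is the supremum of the norms on `U`. Openness keeps it from being attained, since any
point of `U` can be pushed slightly outwards. -/
lemma exists_eq_ball_of_isOpen {V : Type*} [NormedAddCommGroup V] [NormedSpace ℝ V] [Nontrivial V]
    {U : Set V} (hU : IsOpen U) (hb : Bornology.IsBounded U)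
    (h : ∀ x y, ‖y‖ < ‖x‖ → x ∈ U → y ∈ U) : ∃ r, 0 ≤ r ∧ U = Metric.ball 0 r := by
  obtain ⟨R, hR⟩ := hb.exists_norm_le
  have hbdd : BddAbove (norm '' U) := ⟨R, by rintro _ ⟨x, hx, rfl⟩; exact hR x hx⟩
  refine ⟨sSup (norm '' U), Real.sSup_nonneg (by rintro _ ⟨x, _, rfl⟩; exact norm_nonneg _), ?_⟩
  ext x
  rw [mem_ball_zero_iff]
  constructor
  · intro hx
    obtain ⟨δ, hδ, hball⟩ := Metric.isOpen_iff.1 hU x hx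
    obtain ⟨e, he, hxe⟩ : ∃ e : V, ‖e‖ = 1 ∧ x = ‖x‖ • e := by
      by_cases h0 : x = 0
      · obtain ⟨e, he⟩ := exists_norm_eq V zero_le_one
        exact ⟨e, he, by simp [h0]⟩
      · have := norm_pos_iff.2 h0
        exact ⟨‖x‖⁻¹ • x, by rw [norm_smul, norm_inv, norm_norm, inv_mul_cancel₀ this.ne'],
          by rw [smul_smul, mul_inv_cancel₀ this.ne', one_smul]⟩
    have hz : x + (δ / 2) • e ∈ U := by
      apply hball
      rw [Metric.mem_ball, dist_eq_norm, add_sub_cancel_left, norm_smul, he, mul_one,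
        Real.norm_of_nonneg (by positivity)]
      linarith
    have hnorm : ‖x + (δ / 2) • e‖ = ‖x‖ + δ / 2 := by
      conv_lhs => rw [hxe]
      rw [← add_smul, norm_smul, he, mul_one, Real.norm_of_nonneg (by positivity)]
    have := le_csSup hbdd (mem_image_of_mem norm hz)
    linarith
  · intro hx
    have hne : (norm '' U).Nonempty := by
      by_contra hemp
      -- The supremum of the empty set is `0` by convention, which matches the empty ball of radius
      -- zero.
      rw [not_nonempty_iff_eq_empty.1 hemp, Real.sSup_empty] at hx
      exact (norm_nonneg x).not_gt hx
    obtain ⟨_, ⟨y, hy, rfl⟩, hxy⟩ := exists_lt_of_lt_csSup hne hx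
    exact h y x hxy hy

/-- A continuous, compactly supported, radially decreasing function equimeasurable with `φ` is the
symmetric decreasing rearrangement of `φ`. -/
theorem symmRearrC_eq_of_radial (hd : 1 ≤ d) {φ : E → ℂ} {g : E → ℝ} (hg : Continuous g)
    (hgc : HasCompactSupport g) (hg0 : ∀ x, 0 ≤ g x) (hga : ∀ x y, ‖x‖ < ‖y‖ → g y ≤ g x)
    (h : ∀ t > 0, volume {x | t < g x} = volume {x | t < ‖φ x‖}) :
    symmRearrC φ = fun x ↦ (g x : ℂ) := by
  have : Nonempty (Fin d) := ⟨⟨0, hd⟩⟩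
  ext x
  have key : symmRearr φ x = ENNReal.ofReal (g x) := by
    rw [← lintegral_Ioi_indicator_superlevel]
    refine setLIntegral_congr_fun measurableSet_Ioi fun t ht ↦ ?_
    have ht : 0 < t := ht
    have hb : Bornology.IsBounded {y | t < g y} := by
      refine hgc.isCompact.isBounded.subset fun y (hy : t < g y) ↦ subset_tsupport g ?_
      exact (ht.trans hy).ne'
    obtain ⟨r, hr, hball⟩ := exists_eq_ball_of_isOpen (isOpen_lt continuous_const hg) hb
      fun y z hzy (hy : t < g y) ↦ hy.trans_le (hga z y hzy)
    have := h t ht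
    rw [hball] at this
    rw [symmRearrSet_eq_ball hd hr this.symm, hball]
  rw [symmRearrC, key, ENNReal.toReal_ofReal (hg0 x)]

end SymmRearr

/-! ### Gaussian energies in Fourier space and in physical space -/

section Fourier

variable {V : Type*} [NormedAddCommGroup V] [InnerProductSpace ℝ V] [FiniteDimensional ℝ V]
  [MeasurableSpace V] [BorelSpace V]

lemma integral_fourier_mul_eq_flip {f g : V → ℂ} (hf : Integrable f) (hg : Integrable g) :
    ∫ ξ, 𝓕 f ξ * g ξ = ∫ x, f x * 𝓕 g x := by
  simpa using! VectorFourier.integral_fourierIntegral_smul_eq_flip (L := innerₗ V)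
    Real.continuous_fourierChar continuous_inner hf hg

lemma continuous_fourier_of_integrable {f : V → ℂ} (hf : Integrable f) : Continuous (𝓕 f) :=
  VectorFourier.fourierIntegral_continuous Real.continuous_fourierChar continuous_inner hf

lemma norm_fourier_le_integral_norm (f : V → ℂ) (ξ : V) : ‖𝓕 f ξ‖ ≤ ∫ x, ‖f x‖ :=
  VectorFourier.norm_fourierIntegral_le_integral_norm _ _ _ _ _

/-- On `L¹ ∩ L²` the Fourier transform on `L²` is given by the Fourier integral. -/
lemma fourier_toLp_ae_eq {f : V → ℂ} (hf1 : Integrable f) (hf2 : MemLp f 2 volume) :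
    (𝓕 (hf2.toLp f) : Lp ℂ 2 (volume : Measure V)) =ᵐ[volume] 𝓕 f := by
  refine ae_eq_of_integral_contDiff_smul_eq ((Lp.memLp _).locallyIntegrable (by norm_num))
    (continuous_fourier_of_integrable hf1).locallyIntegrable fun g hg hgc ↦ ?_
  have hg₁ : HasCompactSupport (Complex.ofRealCLM ∘ g) := hgc.comp_left rfl
  have hg₂ : ContDiff ℝ (⊤ : ℕ∞) (Complex.ofRealCLM ∘ g) := by fun_prop
  let h : SchwartzMap V ℂ := hg₁.toSchwartzMap hg₂
  have hh : ∀ x, h x = (g x : ℂ) := fun x ↦ rfl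
  -- Both transforms are tested against a smooth bump: on the `L²` side through the tempered
  -- distribution, on the `L¹` side through the flip formula.
  have key := congrArg (fun T ↦ T h) (Lp.fourier_toTemperedDistribution_eq (hf2.toLp f))
  simp only [TemperedDistribution.fourier_apply, Lp.toTemperedDistribution_apply, hh] at key
  have e1 : ∫ x, (𝓕 h : SchwartzMap V ℂ) x • (hf2.toLp f : V → ℂ) x
      = ∫ x, f x * 𝓕 (h : V → ℂ) x := by
    refine integral_congr_ae ?_
    filter_upwards [hf2.coeFn_toLp] with x hx
    rw [hx, smul_eq_mul, mul_comm, SchwartzMap.fourier_coe]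
  rw [e1, ← integral_fourier_mul_eq_flip hf1 h.integrable] at key
  simp only [hh] at key
  simp only [Complex.real_smul]
  simp only [smul_eq_mul] at key
  rw [← key]
  congr 1 with x
  ring

/-- The heat kernel whose Fourier transform is `exp (-t ‖ξ‖ ^ 2)`, as a function of the radius. -/
noncomputable def heatProfile (n : ℕ) (t r : ℝ) : ℝ :=
  (Real.pi / t) ^ ((n : ℝ) / 2) * Real.exp (-(Real.pi ^ 2 / t) * r ^ 2)

lemma heatProfile_nonneg (n : ℕ) {t : ℝ} (ht : 0 < t) (r : ℝ) : 0 ≤ heatProfile n t r := by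
  have := Real.pi_pos
  unfold heatProfile
  positivity

lemma continuous_heatProfile (n : ℕ) (t : ℝ) : Continuous (heatProfile n t) := by
  unfold heatProfile
  fun_prop

lemma antitoneOn_heatProfile (n : ℕ) {t : ℝ} (ht : 0 < t) :
    AntitoneOn (heatProfile n t) (Ici 0) := by
  intro a ha b hb hab
  have := Real.pi_pos
  have ha : 0 ≤ a := ha
  unfold heatProfile
  refine mul_le_mul_of_nonneg_left (Real.exp_le_exp.2 ?_) (by positivity)
  rw [neg_mul, neg_mul, neg_le_neg_iff]
  gcongr

lemma fourier_gaussian_eq_heatProfile {t : ℝ} (ht : 0 < t) (x w : V) :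
    𝓕 (fun v : V ↦ Complex.exp (-t * ‖v‖ ^ 2 + 2 * Real.pi * Complex.I * (inner ℝ x v : ℝ))) w
      = (heatProfile (Module.finrank ℝ V) t ‖x - w‖ : ℂ) := by
  rw [fourier_gaussian_innerProductSpace' (by simpa using ht), heatProfile]
  push_cast
  rw [Complex.ofReal_cpow (by have := Real.pi_pos; positivity)]
  push_cast
  congr 2
  field_simp

lemma fourier_conj_neg (f : V → ℂ) (ξ : V) :
    𝓕 (fun y ↦ (starRingEnd ℂ) (f (-y))) ξ = (starRingEnd ℂ) (𝓕 f ξ) := by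
  rw [Real.fourier_eq', Real.fourier_eq', ← integral_conj, ← integral_neg_eq_self]
  congr 1 with y
  simp only [neg_neg, inner_neg_left, smul_eq_mul, map_mul, ← Complex.exp_conj, Complex.conj_I,
    Complex.conj_ofReal]
  congr 2
  push_cast
  ring

lemma integrable_gaussian {t : ℝ} (ht : 0 < t) : Integrable fun v : V ↦ Real.exp (-t * ‖v‖ ^ 2) := by
  have h := GaussianFourier.integrable_cexp_neg_mul_sq_norm_add (b := (t : ℂ)) (V := V)
    (by simpa using ht) 0 0
  have := h.norm
  simpa [Complex.norm_exp, ← Complex.ofReal_pow] using this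

lemma integrable_gaussian_mul_norm_fourier_sq {f : V → ℂ} (hf : Integrable f) {t : ℝ}
    (ht : 0 < t) : Integrable fun ξ ↦ Real.exp (-t * ‖ξ‖ ^ 2) * ‖𝓕 f ξ‖ ^ 2 := by
  have hc := continuous_fourier_of_integrable hf
  refine (integrable_gaussian ht).mul_bdd (c := (∫ x, ‖f x‖) ^ 2) (by fun_prop) ?_
  filter_upwards with ξ
  rw [norm_pow, norm_norm]
  gcongr
  exact norm_fourier_le_integral_norm f ξ

/-- With `F y = conj (f (-y))` one has `𝓕 F = conj (𝓕 f)`, so `‖𝓕 f‖ ^ 2` is a product of two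
transforms. Applying the flip formula twice moves both onto the Gaussian, which becomes the heat
kernel. -/
lemma integral_gaussian_mul_norm_fourier_sq {f : V → ℂ} (hf : Continuous f)
    (hfc : HasCompactSupport f) {t : ℝ} (ht : 0 < t) :
    ((∫ ξ, Real.exp (-t * ‖ξ‖ ^ 2) * ‖𝓕 f ξ‖ ^ 2 : ℝ) : ℂ)
      = ∫ p : V × V, (heatProfile (Module.finrank ℝ V) t ‖p.1 - p.2‖ : ℂ)
        * (f p.1 * (starRingEnd ℂ) (f p.2)) := by
  have hi : Integrable f := hf.integrable_of_hasCompactSupport hfc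
  set F : V → ℂ := fun y ↦ (starRingEnd ℂ) (f (-y)) with hF
  have hFi : Integrable F := (hi.comp_neg).norm.mono' (by fun_prop) (by simp [hF])
  set e : V → V → ℂ := fun x v ↦
    Complex.exp (-t * ‖v‖ ^ 2 + 2 * Real.pi * Complex.I * (inner ℝ x v : ℝ)) with he
  have hei : ∀ x, Integrable (e x) := fun x ↦
    GaussianFourier.integrable_cexp_neg_mul_sq_norm_add (by simpa using ht) _ _
  have hg : Integrable fun ξ ↦ e 0 ξ * 𝓕 F ξ := by
    refine (hei 0).mul_bdd (c := ∫ x, ‖F x‖)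
      (continuous_fourier_of_integrable hFi).aestronglyMeasurable ?_
    filter_upwards with ξ using norm_fourier_le_integral_norm F ξ
  have step1 : ((∫ ξ, Real.exp (-t * ‖ξ‖ ^ 2) * ‖𝓕 f ξ‖ ^ 2 : ℝ) : ℂ)
      = ∫ ξ, 𝓕 f ξ * (e 0 ξ * 𝓕 F ξ) := by
    rw [← integral_complex_ofReal]
    congr 1 with ξ
    rw [hF, fourier_conj_neg, he]
    simp only [inner_zero_left, Complex.ofReal_zero, mul_zero, add_zero]
    rw [mul_left_comm, Complex.mul_conj, Complex.normSq_eq_norm_sq]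
    push_cast
    rfl
  have step2 : ∀ x, 𝓕 (fun ξ ↦ e 0 ξ * 𝓕 F ξ) x
      = ∫ y, (heatProfile (Module.finrank ℝ V) t ‖x - y‖ : ℂ) * (starRingEnd ℂ) (f y) := by
    intro x
    -- The Fourier character at `x` is absorbed into the modulated Gaussian; its sign turns the
    -- parameter into `-x`.
    have h1 : 𝓕 (fun ξ ↦ e 0 ξ * 𝓕 F ξ) x = ∫ ξ, 𝓕 F ξ * e (-x) ξ := by
      rw [Real.fourier_eq']
      congr 1 with ξ
      rw [smul_eq_mul, ← mul_assoc, mul_comm, he]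
      simp only [inner_zero_left, Complex.ofReal_zero, mul_zero, add_zero, ← Complex.exp_add]
      congr 2
      rw [inner_neg_left, real_inner_comm]
      push_cast
      ring
    rw [h1, integral_fourier_mul_eq_flip hFi (hei _), ← integral_neg_eq_self]
    congr 1 with y
    rw [he, fourier_gaussian_eq_heatProfile ht, hF, mul_comm]
    simp only [neg_neg]
    congr 3
    rw [← norm_neg]
    congr 1
    abel
  have hprod : Integrable fun p : V × V ↦ (heatProfile (Module.finrank ℝ V) t ‖p.1 - p.2‖ : ℂ)
        * (f p.1 * (starRingEnd ℂ) (f p.2)) := by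
    have hh := continuous_heatProfile (Module.finrank ℝ V) t
    refine integrable_of_eq_zero_of_notMem (by fun_prop)
      (hfc.isCompact.prod hfc.isCompact) fun p hp ↦ ?_
    rw [mem_prod, not_and_or] at hp
    rcases hp with hp | hp <;> simp [image_eq_zero_of_notMem_tsupport hp]
  rw [step1, integral_fourier_mul_eq_flip hi hg, Measure.volume_eq_prod, integral_prod _ hprod]
  congr 1 with x
  rw [step2, ← integral_const_mul]
  congr 1 with y
  ring

end Fourier

/-! ### Rearrangement increases Gaussian energies -/

section HeatInequality

variable {d : ℕ}

local notation "E" => EuclideanSpace ℝ (Fin d)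

/-- For continuous compactly supported functions, the rearrangement is again such a function, and
it increases the heat energy. -/
lemma exists_symmRearrC_eq_and_heat_le (hd : 1 ≤ d) {φ : E → ℂ} (hφ : Continuous φ)
    (hφc : HasCompactSupport φ) :
    Continuous (symmRearrC φ) ∧ HasCompactSupport (symmRearrC φ) ∧ ∀ t > 0,
      ∫ ξ, Real.exp (-t * ‖ξ‖ ^ 2) * ‖𝓕 φ ξ‖ ^ 2
        ≤ ∫ ξ, Real.exp (-t * ‖ξ‖ ^ 2) * ‖𝓕 (symmRearrC φ) ξ‖ ^ 2 := by
  have key : ∀ t > 0, Continuous (symmRearrC φ) ∧ HasCompactSupport (symmRearrC φ) ∧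
      ∫ ξ, Real.exp (-t * ‖ξ‖ ^ 2) * ‖𝓕 φ ξ‖ ^ 2
        ≤ ∫ ξ, Real.exp (-t * ‖ξ‖ ^ 2) * ‖𝓕 (symmRearrC φ) ξ‖ ^ 2 := by
    intro t ht
    set k := heatProfile (Module.finrank ℝ E) t with hk
    obtain ⟨g, hg, hgc, hg0, hga, hgm, hle⟩ := exists_radial_rearrangement hφ.norm hφc.norm
      (fun x ↦ norm_nonneg _) (continuous_heatProfile (Module.finrank ℝ E) t)
      (antitoneOn_heatProfile _ ht)
    have heq := symmRearrC_eq_of_radial hd hg hgc hg0 hga hgm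
    have hc : Continuous (symmRearrC φ) := by rw [heq]; fun_prop
    have hcc : HasCompactSupport (symmRearrC φ) := by
      rw [heq]; exact hgc.comp_left (g := fun r : ℝ ↦ (r : ℂ)) Complex.ofReal_zero
    refine ⟨hc, hcc, ?_⟩
    have e1 := integral_gaussian_mul_norm_fourier_sq hφ hφc ht
    have e2 := integral_gaussian_mul_norm_fourier_sq hc hcc ht
    have e3 : ∫ ξ, Real.exp (-t * ‖ξ‖ ^ 2) * ‖𝓕 (symmRearrC φ) ξ‖ ^ 2
        = ∫ p : E × E, k ‖p.1 - p.2‖ * (g p.1 * g p.2) := by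
      apply Complex.ofReal_injective
      rw [e2, ← integral_complex_ofReal]
      congr 1 with p
      rw [heq]
      push_cast
      rw [Complex.conj_ofReal]
    rw [e3]
    refine le_trans ?_ hle
    calc
      -- The heat kernel is nonnegative, so the triangle inequality passes from `φ` to `|φ|`, to
      -- which the radial rearrangement applies.
      _ ≤ ‖((∫ ξ, Real.exp (-t * ‖ξ‖ ^ 2) * ‖𝓕 φ ξ‖ ^ 2 : ℝ) : ℂ)‖ := by
        rw [Complex.norm_real]; exact le_abs_self _
      _ ≤ ∫ p : E × E, ‖(k ‖p.1 - p.2‖ : ℂ) * (φ p.1 * (starRingEnd ℂ) (φ p.2))‖ := by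
        rw [e1]; exact norm_integral_le_integral_norm _
      _ = _ := by
        congr 1 with p
        rw [norm_mul, norm_mul, Complex.norm_real, RCLike.norm_conj,
          Real.norm_of_nonneg (heatProfile_nonneg _ ht _)]
  -- Continuity and compact support do not involve `t`, so any positive value yields them.
  exact ⟨(key 1 one_pos).1, (key 1 one_pos).2.1, fun t ht ↦ (key t ht).2.2⟩

end HeatInequality

/-! ### From Gaussians to the Sobolev weight -/

section Subordination

variable {V : Type*} [NormedAddCommGroup V]

lemma ofReal_rpow_neg_mul_Gamma {s : ℝ} (hs : 0 < s) (ξ : V) :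
    ENNReal.ofReal ((1 + ‖ξ‖ ^ 2) ^ (-s)) * ENNReal.ofReal (Real.Gamma s)
      = ∫⁻ t in Ioi (0 : ℝ), ENNReal.ofReal (t ^ (s - 1) * Real.exp (-t))
        * ENNReal.ofReal (Real.exp (-t * ‖ξ‖ ^ 2)) := by
  have hr : 0 < 1 + ‖ξ‖ ^ 2 := by positivity
  have h := Real.integral_rpow_mul_exp_neg_mul_Ioi hs hr
  have hpos : 0 < (1 / (1 + ‖ξ‖ ^ 2)) ^ s * Real.Gamma s :=
    mul_pos (by positivity) (Real.Gamma_pos_of_pos hs)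
  have hint : IntegrableOn (fun t : ℝ ↦ t ^ (s - 1) * Real.exp (-((1 + ‖ξ‖ ^ 2) * t))) (Ioi 0) := by
    -- A non-integrable integrand would have integral `0` by convention, contradicting the positive
    -- Gamma value.
    by_contra hn
    rw [integral_undef hn] at h
    exact hpos.ne h
  rw [← ENNReal.ofReal_mul (by positivity), Real.rpow_neg hr.le, ← Real.inv_rpow hr.le, ← one_div,
    ← h, ofReal_integral_eq_lintegral_ofReal hint]
  · refine setLIntegral_congr_fun measurableSet_Ioi fun t ht ↦ ?_
    have ht : 0 < t := ht
    rw [← ENNReal.ofReal_mul (by positivity), mul_assoc, ← Real.exp_add]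
    congr 3
    ring
  · filter_upwards [ae_restrict_mem measurableSet_Ioi] with t ht
    have ht : 0 < t := ht
    change 0 ≤ t ^ (s - 1) * Real.exp (-((1 + ‖ξ‖ ^ 2) * t))
    positivity

variable [InnerProductSpace ℝ V] [FiniteDimensional ℝ V] [MeasurableSpace V] [BorelSpace V]

lemma lintegral_rpow_neg_mul_Gamma {s : ℝ} (hs : 0 < s) {F : V → ℝ≥0∞} (hF : Measurable F) :
    (∫⁻ ξ, ENNReal.ofReal ((1 + ‖ξ‖ ^ 2) ^ (-s)) * F ξ) * ENNReal.ofReal (Real.Gamma s)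
      = ∫⁻ t in Ioi (0 : ℝ), ENNReal.ofReal (t ^ (s - 1) * Real.exp (-t))
        * ∫⁻ ξ, ENNReal.ofReal (Real.exp (-t * ‖ξ‖ ^ 2)) * F ξ := by
  have m1 : Measurable fun t : ℝ ↦ ENNReal.ofReal (t ^ (s - 1) * Real.exp (-t)) := by fun_prop
  have m2 : Measurable fun p : V × ℝ ↦ ENNReal.ofReal (Real.exp (-p.2 * ‖p.1‖ ^ 2)) := by fun_prop
  rw [← lintegral_mul_const _ (by fun_prop)]
  simp_rw [mul_right_comm _ _ (ENNReal.ofReal (Real.Gamma s)), ofReal_rpow_neg_mul_Gamma hs]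
  have m3 : ∀ ξ : V, Measurable fun t : ℝ ↦ ENNReal.ofReal (t ^ (s - 1) * Real.exp (-t))
      * ENNReal.ofReal (Real.exp (-t * ‖ξ‖ ^ 2)) := by intro ξ; fun_prop
  simp_rw [fun ξ : V ↦ (lintegral_mul_const (F ξ) (μ := volume.restrict (Ioi (0 : ℝ))) (m3 ξ)).symm]
  rw [lintegral_lintegral_swap (by fun_prop)]
  congr 1 with t
  rw [← lintegral_const_mul _ (by fun_prop)]
  simp_rw [mul_assoc]

lemma lintegral_rpow_neg_mul_fourier_le {s : ℝ} (hs : 0 < s) {f g : V → ℂ} (hf : Integrable f)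
    (hg : Integrable g) (h : ∀ t > 0, ∫ ξ, Real.exp (-t * ‖ξ‖ ^ 2) * ‖𝓕 f ξ‖ ^ 2
      ≤ ∫ ξ, Real.exp (-t * ‖ξ‖ ^ 2) * ‖𝓕 g ξ‖ ^ 2) :
    ∫⁻ ξ, ENNReal.ofReal ((1 + ‖ξ‖ ^ 2) ^ (-s)) * ‖𝓕 f ξ‖ₑ ^ 2
      ≤ ∫⁻ ξ, ENNReal.ofReal ((1 + ‖ξ‖ ^ 2) ^ (-s)) * ‖𝓕 g ξ‖ₑ ^ 2 := by
  have hfm := (continuous_fourier_of_integrable hf).measurable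
  have hgm := (continuous_fourier_of_integrable hg).measurable
  have conv : ∀ {f : V → ℂ}, Integrable f → ∀ {t : ℝ}, 0 < t →
      ∫⁻ ξ, ENNReal.ofReal (Real.exp (-t * ‖ξ‖ ^ 2)) * ‖𝓕 f ξ‖ₑ ^ 2
        = ENNReal.ofReal (∫ ξ, Real.exp (-t * ‖ξ‖ ^ 2) * ‖𝓕 f ξ‖ ^ 2) := by
    intro f hf t ht
    rw [ofReal_integral_eq_lintegral_ofReal (integrable_gaussian_mul_norm_fourier_sq hf ht)
      (.of_forall fun ξ ↦ by positivity)]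
    congr 1 with ξ
    rw [ENNReal.ofReal_mul (by positivity), ENNReal.ofReal_pow (norm_nonneg _), ofReal_norm]
  refine (ENNReal.mul_le_mul_iff_left (c := ENNReal.ofReal (Real.Gamma s))
    (by simpa using Real.Gamma_pos_of_pos hs) ENNReal.ofReal_ne_top).1 ?_
  rw [lintegral_rpow_neg_mul_Gamma hs (by fun_prop), lintegral_rpow_neg_mul_Gamma hs (by fun_prop)]
  refine setLIntegral_mono' measurableSet_Ioi fun t ht ↦ ?_
  rw [conv hf ht, conv hg ht]
  exact mul_le_mul_right (ENNReal.ofReal_le_ofReal (h t ht)) _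

end Subordination

/-! ### The norm of order `-s` and the passage to `L²` -/

section SobolevNorm

variable {d : ℕ}

local notation "E" => EuclideanSpace ℝ (Fin d)

/-- The measure with density `(1 + ‖ξ‖ ^ 2) ^ (-s)`. -/
noncomputable def sobolevMeasure (d : ℕ) (s : ℝ) : Measure (EuclideanSpace ℝ (Fin d)) :=
  volume.withDensity fun ξ ↦ ENNReal.ofReal ((1 + ‖ξ‖ ^ 2) ^ (-s))

/-- The norm of `u` in the Sobolev space of order `-s`. -/
noncomputable def negSobolevNorm (s : ℝ) (u : Lp ℂ 2 (volume : Measure E)) : ℝ≥0∞ :=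
  eLpNorm (𝓕 u : Lp ℂ 2 (volume : Measure E)) 2 (sobolevMeasure d s)

lemma rpow_neg_le_one {s : ℝ} (hs : 0 < s) (ξ : E) : (1 + ‖ξ‖ ^ 2) ^ (-s) ≤ 1 :=
  Real.rpow_le_one_of_one_le_of_nonpos (le_add_of_nonneg_right (by positivity)) (by linarith)

lemma sobolevMeasure_le {s : ℝ} (hs : 0 < s) : sobolevMeasure d s ≤ volume := by
  conv_rhs => rw [← withDensity_one (μ := (volume : Measure E))]
  refine withDensity_mono (.of_forall fun ξ ↦ ?_)
  simpa using rpow_neg_le_one hs ξ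

/-- The weight is at most `1`, and Plancherel gives the rest. This is the continuity used in the
approximation argument. -/
lemma negSobolevNorm_le {s : ℝ} (hs : 0 < s) (u : Lp ℂ 2 (volume : Measure E)) :
    negSobolevNorm s u ≤ ‖u‖ₑ := by
  refine (eLpNorm_mono_measure _ (sobolevMeasure_le hs)).trans_eq ?_
  rw [← Lp.enorm_def, ← ofReal_norm, Lp.norm_fourier_eq, ofReal_norm]

lemma negSobolevNorm_le_add {s : ℝ} (hs : 0 < s) (u v : Lp ℂ 2 (volume : Measure E)) :
    negSobolevNorm s u ≤ negSobolevNorm s v + ‖u - v‖ₑ := by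
  have hac : sobolevMeasure d s ≪ volume := withDensity_absolutelyContinuous _ _
  have h : 𝓕 u = 𝓕 v + 𝓕 (u - v) := by rw [← FourierTransform.fourier_add, add_sub_cancel]
  calc
    negSobolevNorm s u = eLpNorm ((𝓕 v : Lp ℂ 2 (volume : Measure E))
        + (𝓕 (u - v) : Lp ℂ 2 (volume : Measure E)) : E → ℂ) 2 (sobolevMeasure d s) := by
      rw [negSobolevNorm, h]
      exact eLpNorm_congr_ae (hac.ae_eq (Lp.coeFn_add _ _))
    _ ≤ negSobolevNorm s v + negSobolevNorm s (u - v) :=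
      eLpNorm_add_le ((Lp.aestronglyMeasurable _).mono_ac hac)
        ((Lp.aestronglyMeasurable _).mono_ac hac) (by norm_num)
    _ ≤ _ := by gcongr; exact negSobolevNorm_le hs _

lemma negSobolevNorm_toLp {s : ℝ} {f : E → ℂ} (hf : MemLp f 2 volume) :
    negSobolevNorm s (hf.toLp f)
      = (∫⁻ ξ, ENNReal.ofReal (negSobolevDensity s f hf ξ)) ^ (1 / 2 : ℝ) := by
  rw [negSobolevNorm, eLpNorm_two_eq_lintegral, sobolevMeasure,
    lintegral_withDensity_eq_lintegral_mul₀ (by fun_prop)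
      ((Lp.aestronglyMeasurable _).enorm.pow_const 2)]
  congr 2 with ξ
  rw [Pi.mul_apply, negSobolevDensity, ENNReal.ofReal_mul (by positivity),
    ENNReal.ofReal_pow (norm_nonneg _), ofReal_norm]

lemma negSobolevDensity_nonneg {s : ℝ} {f : E → ℂ} (hf : MemLp f 2 volume) (ξ : E) :
    0 ≤ negSobolevDensity s f hf ξ := by
  unfold negSobolevDensity
  positivity

lemma integrable_negSobolevDensity {s : ℝ} (hs : 0 < s) {f : E → ℂ} (hf : MemLp f 2 volume) :
    Integrable (negSobolevDensity s f hf) volume := by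
  have h := (Lp.memLp (𝓕 (hf.toLp f) : Lp ℂ 2 (volume : Measure E))).integrable_norm_pow
    (by norm_num)
  refine Integrable.bdd_mul (c := 1) h ?_ ?_
  · exact Measurable.aestronglyMeasurable (by fun_prop)
  · filter_upwards with ξ
    rw [Real.norm_of_nonneg (by positivity)]
    exact rpow_neg_le_one hs ξ

lemma negSobolevNorm_symmRearrC_of_continuous (hd : 1 ≤ d) {s : ℝ} (hs : 0 < s) {φ : E → ℂ}
    (hφ : Continuous φ) (hφc : HasCompactSupport φ) (hφ2 : MemLp φ 2 volume)
    (hφ2' : MemLp (symmRearrC φ) 2 volume) :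
    negSobolevNorm s (hφ2.toLp φ) ≤ negSobolevNorm s (hφ2'.toLp (symmRearrC φ)) := by
  obtain ⟨hc, hcc, hheat⟩ := exists_symmRearrC_eq_and_heat_le hd hφ hφc
  have hi := hφ.integrable_of_hasCompactSupport (μ := volume) hφc
  have hi' := hc.integrable_of_hasCompactSupport (μ := volume) hcc
  have conv : ∀ {f : E → ℂ} (_ : Integrable f) (hf : MemLp f 2 volume),
      ∫⁻ ξ, ENNReal.ofReal (negSobolevDensity s f hf ξ)
        = ∫⁻ ξ, ENNReal.ofReal ((1 + ‖ξ‖ ^ 2) ^ (-s)) * ‖𝓕 f ξ‖ₑ ^ 2 := by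
    intro f hf1 hf
    refine lintegral_congr_ae ?_
    filter_upwards [fourier_toLp_ae_eq hf1 hf] with ξ hξ
    rw [negSobolevDensity, ENNReal.ofReal_mul (by positivity), ENNReal.ofReal_pow (norm_nonneg _),
      ofReal_norm, hξ]
  rw [negSobolevNorm_toLp, negSobolevNorm_toLp, conv hi, conv hi']
  exact ENNReal.rpow_le_rpow (lintegral_rpow_neg_mul_fourier_le hs hi hi' hheat) (by norm_num)

lemma negSobolevNorm_symmRearrC (hd : 1 ≤ d) {s : ℝ} (hs : 0 < s) {φ : E → ℂ}
    (hφ2 : MemLp φ 2 volume) (hφ2' : MemLp (symmRearrC φ) 2 volume) :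
    negSobolevNorm s (hφ2.toLp φ) ≤ negSobolevNorm s (hφ2'.toLp (symmRearrC φ)) := by
  refine ENNReal.le_of_forall_pos_le_add fun ε hε _ ↦ ?_
  -- One `ε / 2` is spent replacing `φ` by `ψ`, the other replacing the rearrangement of `ψ` by that
  -- of `φ`; nonexpansiveness allows the same bound for both.
  obtain ⟨ψ, hψc, hψ, hψcont, hψ2⟩ := hφ2.exists_hasCompactSupport_eLpNorm_sub_le
    (by norm_num) (ε := (ε / 2 : NNReal)) (by simpa using hε.ne')
  have hψ2' := memLp_symmRearrC hd hψ2
  have e1 : ‖hφ2.toLp φ - hψ2.toLp ψ‖ₑ ≤ (ε / 2 : NNReal) := by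
    rw [← MemLp.toLp_sub, Lp.enorm_toLp]; exact hψ
  have e2 : ‖hψ2'.toLp (symmRearrC ψ) - hφ2'.toLp (symmRearrC φ)‖ₑ ≤ (ε / 2 : NNReal) := by
    rw [← MemLp.toLp_sub, Lp.enorm_toLp, eLpNorm_sub_comm]
    exact (eLpNorm_symmRearrC_sub_le hd hφ2 hψ2).trans hψ
  calc
    _ ≤ negSobolevNorm s (hψ2.toLp ψ) + (ε / 2 : NNReal) :=
      (negSobolevNorm_le_add hs _ _).trans (by gcongr)
    _ ≤ negSobolevNorm s (hψ2'.toLp (symmRearrC ψ)) + (ε / 2 : NNReal) := by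
      gcongr
      exact negSobolevNorm_symmRearrC_of_continuous hd hs hψcont hψc hψ2 hψ2'
    _ ≤ negSobolevNorm s (hφ2'.toLp (symmRearrC φ)) + (ε / 2 : NNReal) + (ε / 2 : NNReal) := by
      gcongr
      exact (negSobolevNorm_le_add hs _ _).trans (by gcongr)
    _ = _ := by
      rw [add_assoc, ← ENNReal.coe_add, add_halves]

end SobolevNorm

theorem mainTheorem5 (d : ℕ) (hd : 1 ≤ d) (s : ℝ) (hs : 0 < s)
    (φ : EuclideanSpace ℝ (Fin d) → ℂ) (hφ : MemLp φ 2 volume) :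
    ∃ hφ' : MemLp (symmRearrC φ) 2 volume,
      Integrable (negSobolevDensity s φ hφ) volume ∧
      Integrable (negSobolevDensity s (symmRearrC φ) hφ') volume ∧
      ∫ ξ, negSobolevDensity s φ hφ ξ ≤ ∫ ξ, negSobolevDensity s (symmRearrC φ) hφ' ξ := by
  have hφ' := memLp_symmRearrC hd hφ
  have hi := integrable_negSobolevDensity hs hφ
  have hi' := integrable_negSobolevDensity hs hφ'
  refine ⟨hφ', hi, hi', ?_⟩
  have h := negSobolevNorm_symmRearrC hd hs hφ hφ'
  rw [negSobolevNorm_toLp, negSobolevNorm_toLp, ENNReal.rpow_le_rpow_iff (by norm_num),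
    ← ofReal_integral_eq_lintegral_ofReal hi (.of_forall (negSobolevDensity_nonneg hφ)),
    ← ofReal_integral_eq_lintegral_ofReal hi' (.of_forall (negSobolevDensity_nonneg hφ'))] at h
  exact (ENNReal.ofReal_le_ofReal_iff (integral_nonneg (negSobolevDensity_nonneg hφ'))).1 h
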